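/- Let $h_1,h_2\ge 2$ and let $D=D(h_1,h_2)$ be the monocircular diagram, that is, the standard diagram of the pretzel link $P(-1,\overset{(h_1)}{\dots},-1,h_2)$. Its all-$A$ smoothing consists of one circle and two ladders of $A$-scars (chords recording the crossings): a ladder $H_1$ with $h_1$ parallel scars (steps), coming from the crossings of the $h_1$ entries $-1$, and a ladder $H_2$ with $h_2$ parallel scars, coming from the entry $h_2$. Order the crossings so that those of $H_1$ come first, from left to right, followed by those of $H_2$, from top to bottom. Let $C(D)$ be the Khovanov complex of $D$ over $\mathbb Z$ in terms of enhanced states. Its generators are the Kauffman states $s$ (labellings of the crossings by $A$ or $B$) together with a sign $\pm$ on each circle of the smoothed diagram $sD$. The homological degree $i$ of a generator is its number of $B$-labels, and its quantum degree is $j=i+\theta$, where $\theta$ is the number of circles with sign $+$ minus the number with sign $-$. The differential is $d(S)=\sum_T i(S,T)\,T$. Here $i(S,T)=(-1)^k$ if $T$ is obtained from $S$ by changing the label of exactly one crossing $x$ from $A$ to $B$, $S$ and $T$ have the same quantum degree, and they give the same signs to the circles not touching $x$, with $k$ the number of $B$-labelled crossings of $S$ previous to $x$; otherwise $i(S,T)=0$.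 Let $\underline{Kh}(D)=\ker d/\operatorname{im} d=\bigoplus_{i,j}\underline{Kh}^{i,j}(D)$. For integers $1\le\mu_1\le h_1$ and $1\le\mu_2\le h_2$, let $s(\mu_1,\mu_2;C_i^{0-})$ be the sum, over all Kauffman states with exactly $\mu_1$ crossings of $H_1$ and exactly $\mu_2$ crossings of $H_2$ labelled $B$, of the enhanced state in which the circle $C_i^0$ has sign $-$ and all other circles have sign $+$. Here $C_i^0$ is the circle through the beginning of the ladder $H_i$, that is, the circle which touches the first $B$-scar of $H_i$ from the side of the beginning of the ladder. Put $$V(\mu,0)=(-1)^{\mu}s(\mu,1;C_1^{0-}),\qquad V(0,\mu')=s(1,\mu';C_2^{0-}).$$ Let $\mu,\mu'$ be odd integers with $1\le\mu<h_1$ and $1\le\mu'<h_2$. Then $V(\mu,0)$ and $V(0,\mu')$ are cycles whose classes $[V(\mu,0)]\in\underline{Kh}^{\mu+1,2\mu-1}(D)$ and $[V(0,\mu')]\in\underline{Kh}^{\mu'+1,2\mu'-1}(D)$ have order two, and, as elements of $\underline{Kh}(D)$, $$[V(\mu,0)]=[V(0,\mu')]\quad\text{if and only if}\quad \mu=\mu'=1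 .$$ -/

import Mathlib

noncomputable section

/-- A planar diagram code of an unoriented link diagram with `N` ordered crossings (numbered by
`Fin N`) and `2 * N` arcs (the pieces of the diagram between consecutive passages through crossings,
numbered by `Fin (2 * N)`).  `arc x 0, arc x 1, arc x 2, arc x 3` are the four arcs
that end at the crossing `x`, in counterclockwise order, starting from one of the two ends of the
under-strand.  In the code of a diagram every arc occurs exactly twice. -/
structure PDCode (N : ℕ) where
  arc : Fin N → Fin 4 → Fin (2 * N)

namespace PDCode

variable {N : ℕ} (D : PDCode N)

/-- A Kauffman state is a labelling of the crossings by `A` and `B`; it is given by the set `s` of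
the crossings labelled `B`.  `D.Joined s a b` says that the arcs `a` and `b` are joined when the
crossings are smoothed according to `s`.
At a crossing with arcs `0, 1, 2, 3`, the `A`-smoothing (which merges the two regions swept when the
over-strand is rotated counterclockwise) joins `0` to `1` and `2` to `3`;
the `B`-smoothing joins `0` to `3` and `1` to `2`. -/
def Joined (s : Finset (Fin N)) (a b : Fin (2 * N)) : Prop :=
  ∃ x : Fin N,
    (x ∉ s ∧ ((a = D.arc x 0 ∧ b = D.arc x 1) ∨ (a = D.arc x 2 ∧ b = D.arc x 3))) ∨
    (x ∈ s ∧ ((a = D.arc x 0 ∧ b = D.arc x 3) ∨ (a = D.arc x 1 ∧ b = D.arc x 2)))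

/-- The circles of the smoothed diagram `sD`: the classes of arcs under the equivalence relation
generated by `Joined`. -/
def Circle (s : Finset (Fin N)) : Type := Quot (D.Joined s)

instance (s : Finset (Fin N)) : Finite (D.Circle s) := inferInstanceAs (Finite (Quot _))

instance (s : Finset (Fin N)) : Fintype (D.Circle s) := Fintype.ofFinite _

/-- The circle of `sD` through the arc `a`. -/
def circle (s : Finset (Fin N)) (a : Fin (2 * N)) : D.Circle s := Quot.mk _ a

/-- An enhanced state: a Kauffman state `s` with a sign for each circle of `sD`. -/
abbrev EnhancedState : Type := Σ s : Finset (Fin N), (D.Circle s → ℤˣ)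

instance : Fintype D.EnhancedState := Fintype.ofFinite _

variable {D}

/-- The homological degree `i(S)`: the number of crossings labelled `B`. -/
def homDegree (S : D.EnhancedState) : ℤ := (S.1.card : ℤ)

/-- `θ(S)`: the number of circles with sign `+` minus the number of circles with sign `-`. -/
def theta (S : D.EnhancedState) : ℤ := ∑ c : D.Circle S.1, ((S.2 c : ℤˣ) : ℤ)

/-- The quantum degree `j(S) = i(S) + θ(S)`. -/
def quantumDegree (S : D.EnhancedState) : ℤ := homDegree S + theta S

/-- `T` is adjacent to `S` with change crossing `x`: the label of `x` changes from `A` to `B` and no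
other label changes (so `i(T) = i(S) + 1`), `j(T) = j(S)`, and `S` and `T` give the same sign
to each common circle, that is, to each circle that does not touch `x`. -/
def AdjacentAt (S T : D.EnhancedState) (x : Fin N) : Prop :=
  x ∉ S.1 ∧ T.1 = insert x S.1 ∧ quantumDegree T = quantumDegree S ∧
    ∀ a : Fin (2 * N), (∀ k : Fin 4, D.circle S.1 a ≠ D.circle S.1 (D.arc x k)) →
      T.2 (D.circle T.1 a) = S.2 (D.circle S.1 a)

open scoped Classical in
/-- The incidence number `i(S, T)`: it is `(-1)^k` if `T` is adjacent to `S`, where `k` is the number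
of crossings labelled `B` in `S` previous to the change crossing, and `0` otherwise.
(At most one term of the sum is not zero.) -/
def incidence (S T : D.EnhancedState) : ℤ :=
  ∑ x : Fin N, if AdjacentAt S T x then (-1) ^ (S.1.filter (fun y => y < x)).card else 0

variable (R : Type*) [CommRing R] (D)

/-- The module `C(D)` of chains, freely generated by the finite set of enhanced states: a chain is
given by its coefficients. -/
abbrev Chain : Type _ := D.EnhancedState → R

/-- The part `C^{i,j}(D)` of `C(D)` generated by the enhanced states of homological degree `i` and
quantum degree `j`. -/
def chainsOfDegree (i j : ℤ) : Submodule R (D.Chain R) where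
  carrier := {c | ∀ S, c S ≠ 0 → homDegree S = i ∧ quantumDegree S = j}
  zero_mem' := fun _ h => absurd rfl h
  add_mem' := by
    intro a b ha hb S h
    by_cases h0 : a S = 0
    · exact hb S (fun h1 => h (by simp [h0, h1]))
    · exact ha S h0
  smul_mem' := by
    intro r a ha S h
    exact ha S (fun h0 => h (by simp [h0]))

/-- The differential, the linear map with `d(S) = ∑ i(S, T) T` (sum over all enhanced states `T`)
for every enhanced state `S`; it maps `C^{i,j}(D)` to `C^{i+1,j}(D)`. -/
def differential : D.Chain R →ₗ[R] D.Chain R :=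
  Fintype.linearCombination R (fun S T : D.EnhancedState => ((incidence S T : ℤ) : R))

/-- The module of cycles. -/
abbrev cycles : Submodule R (D.Chain R) := LinearMap.ker (D.differential R)

/-- The (total) Khovanov homology `ker d / im d` of the diagram. It is the direct sum of the
bigraded modules `Kh^{i,j}(D)` below, since `d` is homogeneous. -/
abbrev Kh : Type _ :=
  D.cycles R ⧸ (LinearMap.range (D.differential R)).submoduleOf (D.cycles R)

/-- The homology class of a cycle. -/
def homologyClass (z : D.cycles R) : D.Kh R := Submodule.Quotient.mk z

/-- The summand `Kh^{i,j}(D)` of the homology: the classes of the cycles in `C^{i,j}(D)`. -/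
def khOfDegree (i j : ℤ) : Submodule R (D.Kh R) :=
  ((D.chainsOfDegree R i j).submoduleOf (D.cycles R)).map
    ((LinearMap.range (D.differential R)).submoduleOf (D.cycles R)).mkQ

end PDCode

/-- The monocircular diagram `D(h₁, h₂)`, the standard diagram of the pretzel link
`P(-1, …, -1, h₂)` with `h₁` entries `-1`.  The crossings are the `h₁` one-crossing columns from left
to right, and then the `h₂` crossings of the last column from top to bottom.
The four arcs at a crossing are at its NW, NE, SE and SW corners.  Let `U_0, …, U_{h₁}` be the
arcs above the row of one-crossing columns, `L_0, …, L_{h₁}` the arcs below it, `P_0, …, P_{h₂}`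
the arcs to the left of the last column and `Q_0, …, Q_{h₂}` the arcs to the right of it, where
`U_{h₁} = P_0`, `P_{h₂} = L_{h₁}`, `L_0 = Q_{h₂}` and `Q_0 = U_0`.  In the cyclic order
`U_0, …, U_{h₁} = P_0, …, P_{h₂} = L_{h₁}, …, L_0 = Q_{h₂}, …, Q_0 = U_0`
in which they follow each other along the unique circle of the all-`A` smoothing, the arcs are
numbered by the integers modulo `2 (h₁ + h₂)`, so that `U_j = j`, `P_k = h₁ + k`,
`L_j = 2 h₁ + h₂ - j` and `Q_k = 2 h₁ + 2 h₂ - k`.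
The `j`-th crossing of the row has NE, NW, SW, SE arcs `U_{j+1}, U_j, L_j, L_{j+1}`, and
the under-strand joins NE to SW; the `k`-th crossing of the last column has NW, SW, SE, NE arcs
`P_k, P_{k+1}, Q_{k+1}, Q_k`, and the under-strand joins NW to SE.
In the all-`A` smoothing, the row is a ladder `H₁` of height `h₁` between the arcs `U` and `L`, and
the last column is a ladder `H₂` of height `h₂` between the arcs `P` and `Q`. -/
def monocircular (h₁ h₂ : ℕ) : PDCode (h₁ + h₂) where
  arc x k :=
    ⟨(Fin.addCases (motive := fun _ => Fin 4 → ℕ)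
        (fun j : Fin h₁ => ![(j : ℕ) + 1, (j : ℕ), 2 * h₁ + h₂ - (j : ℕ), 2 * h₁ + h₂ - ((j : ℕ) + 1)])
        (fun l : Fin h₂ => ![h₁ + (l : ℕ), h₁ + ((l : ℕ) + 1), 2 * h₁ + 2 * h₂ - ((l : ℕ) + 1),
          2 * h₁ + 2 * h₂ - (l : ℕ)])
        x k) % (2 * (h₁ + h₂)),
      Nat.mod_lt _ (by have := x.pos; omega)⟩

open scoped Classical in
/-- The enhancement of a state in which the circle through the arc number `a` has sign `-` and all
the other circles have sign `+`. -/
def negAt {N : ℕ} (D : PDCode N) (s : Finset (Fin N)) (a : ℕ) : D.EnhancedState :=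
  ⟨s, fun c => if ∃ e : Fin (2 * N), (e : ℕ) = a ∧ D.circle s e = c then -1 else 1⟩

open scoped Classical in
/-- The chain of `D(h₁, h₂)` that is the sum, over all Kauffman states in which exactly `m₁` steps of
the ladder `H₁` and `m₂` steps of the ladder `H₂` are labelled `B`, of the
enhancement in which exactly the circle through the arc number `a` has sign `-`. -/
def ladderSum (h₁ h₂ m₁ m₂ a : ℕ) : (monocircular h₁ h₂).Chain ℤ :=
  ∑ s ∈ (Finset.univ : Finset (Finset (Fin (h₁ + h₂)))).filter (fun s =>
      (s.filter (fun x : Fin (h₁ + h₂) => (x : ℕ) < h₁)).card = m₁ ∧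
      (s.filter (fun x : Fin (h₁ + h₂) => h₁ ≤ (x : ℕ))).card = m₂),
    Pi.single (negAt (monocircular h₁ h₂) s a) 1

/-- `V(μ, 0) = (-1)^μ s(μ, 1; C₁^{0-})`.  The circle `C₁^0` is the periphery circle of `H₁`
that touches the first red scar (`B`-label) of `H₁` from the side of the beginning of the ladder. It
runs through the arc at the beginning of `H₁`, which is `U_0 = 0`, because all the scars of `H₁`
before its first red scar are blue. -/
def chainLeft (h₁ h₂ μ : ℕ) : (monocircular h₁ h₂).Chain ℤ :=
  (-1 : ℤ) ^ μ • ladderSum h₁ h₂ μ 1 0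

/-- `V(0, μ) = s(1, μ; C₂^{0-})`.  The circle `C₂^0` is the periphery circle of `H₂` that touches
the first red scar of `H₂`; it runs through the arc at the beginning of `H₂`,
which is `P_0 = h₁`. -/
def chainRight (h₁ h₂ μ : ℕ) : (monocircular h₁ h₂).Chain ℤ :=
  ladderSum h₁ h₂ 1 μ h₁

end

/-! ### Circles of a smoothed diagram when one label changes. -/

namespace PDCode

variable {N : ℕ} {D : PDCode N}

/-! As soon as both ladders carry a `B`-label, one circle passes through all four corners
(`through_corners`). So $C_1^0$ and $C_2^0$ are the same circle. Writing $z(m_1,m_2)$ for `minusSum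
hN m₁ m₂ 0`, where the corner circle is the only negative one, $V(\mu,0)=-z(\mu,1)$ and
$V(0,\mu')=z(1,\mu')$.

A new `B`-label splits a circle if its own ladder is already labelled or the other ladder is not. It
merges two circles if it is the first in its ladder while the other ladder is labelled. The two
outcomes of a split at step $x$ belong to the consecutive arcs $x$ and $x+1$ of one side of the
ladder, and the sign of the differential alternates along the labelled steps. Summed over a ladder,
the contributions telescope (`sum_alternating`) and only the two corners survive. For $z(m_1,m_2)$
the corner circle is already negative, so nothing survives and $z$ is a cycle. For the sum of
all-plus states the two corner terms add up to $\pm 2z$ in the ladder whose new number of labels is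
odd, and cancel in the other one. This gives $2[z(\mu,1)]=0=2[z(1,\mu')]$ except for $z(1,1)$, where
merges from states with $H_1$ unlabelled provide the bounding chain (`differential_minusSum_one`).

Non-triviality comes from a cocycle modulo two (`detector`). On one state of type $(m_1,m_2)$, take
the enhancements with a single minus. Splits contribute evenly to its coboundary. Merges contribute
oddly, and are compensated by enhancements of a state with one ladder unlabelled. This cocycle pairs
with $z(n_1,n_2)$ to $1$ exactly when $(n_1,n_2)=(m_1,m_2)$. Since $(\mu,1)=(1,\mu')$ only for
$\mu=\mu'=1$, the classes differ otherwise; in that case $V(1,0)-V(0,1)=-2z(1,1)$ is a boundary. -/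

theorem circle_eq_of_joined {s : Finset (Fin N)} {a b : Fin (2 * N)} (h : D.Joined s a b) :
    D.circle s a = D.circle s b := Quot.sound h

theorem circle_surjective (s : Finset (Fin N)) : Function.Surjective (D.circle s) :=
  Quot.mk_surjective

/-- Two arcs on the same circle are related by every equivalence relation that contains
`Joined`. -/
theorem rel_of_circle_eq {s : Finset (Fin N)} {r : Fin (2 * N) → Fin (2 * N) → Prop}
    (hr : Equivalence r) (h : ∀ a b, D.Joined s a b → r a b) {a b : Fin (2 * N)}
    (hab : D.circle s a = D.circle s b) : r a b := by
  let st : Setoid (Fin (2 * N)) := ⟨r, hr⟩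
  exact Quotient.exact (s := st) (congrArg (Quot.lift (fun a => (Quotient.mk st a))
    (fun a b hab => Quotient.sound (h a b hab))) hab)

theorem eq_of_circle_eq {s : Finset (Fin N)} {α : Type*} (f : Fin (2 * N) → α)
    (h : ∀ a b, D.Joined s a b → f a = f b) {a b : Fin (2 * N)}
    (hab : D.circle s a = D.circle s b) : f a = f b :=
  rel_of_circle_eq (r := fun a b => f a = f b)
    ⟨fun _ => rfl, fun h => h.symm, fun h h' => h.trans h'⟩ h hab

theorem circle_arc_of_notMem {s : Finset (Fin N)} {x : Fin N} (hx : x ∉ s) :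
    D.circle s (D.arc x 0) = D.circle s (D.arc x 1) ∧
      D.circle s (D.arc x 2) = D.circle s (D.arc x 3) :=
  ⟨circle_eq_of_joined ⟨x, Or.inl ⟨hx, Or.inl ⟨rfl, rfl⟩⟩⟩,
    circle_eq_of_joined ⟨x, Or.inl ⟨hx, Or.inr ⟨rfl, rfl⟩⟩⟩⟩

theorem circle_arc_of_mem {s : Finset (Fin N)} {x : Fin N} (hx : x ∈ s) :
    D.circle s (D.arc x 0) = D.circle s (D.arc x 3) ∧
      D.circle s (D.arc x 1) = D.circle s (D.arc x 2) :=
  ⟨circle_eq_of_joined ⟨x, Or.inr ⟨hx, Or.inl ⟨rfl, rfl⟩⟩⟩,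
    circle_eq_of_joined ⟨x, Or.inr ⟨hx, Or.inr ⟨rfl, rfl⟩⟩⟩⟩

/-- If two states differ at most at the crossing `x`, then two arcs on a common circle of the first
are on a common circle of the second, or on circles of the second that touch `x`. -/
theorem circle_eq_or_touch {s t : Finset (Fin N)} {x : Fin N} (h : ∀ y, y ≠ x → (y ∈ s ↔ y ∈ t))
    {a b : Fin (2 * N)} (hab : D.circle s a = D.circle s b) :
    D.circle t a = D.circle t b ∨
      ((∃ k, D.circle t a = D.circle t (D.arc x k)) ∧
        ∃ k, D.circle t b = D.circle t (D.arc x k)) := by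
  refine rel_of_circle_eq (D := D) (s := s) (r := fun a b => D.circle t a = D.circle t b ∨
      ((∃ k, D.circle t a = D.circle t (D.arc x k)) ∧
        ∃ k, D.circle t b = D.circle t (D.arc x k))) ⟨fun a => Or.inl rfl, ?_, ?_⟩ ?_ hab
  · rintro a b (h | ⟨h, h'⟩)
    · exact Or.inl h.symm
    · exact Or.inr ⟨h', h⟩
  · rintro a b c (h | ⟨h, h'⟩) (k | ⟨k, k'⟩)
    · exact Or.inl (h.trans k)
    · exact Or.inr ⟨by rwa [h], k'⟩
    · exact Or.inr ⟨h, by rwa [← k]⟩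
    · exact Or.inr ⟨h, k'⟩
  · rintro a b ⟨y, hy⟩
    by_cases hyx : y = x
    · subst hyx
      rcases hy with ⟨-, ⟨rfl, rfl⟩ | ⟨rfl, rfl⟩⟩ | ⟨-, ⟨rfl, rfl⟩ | ⟨rfl, rfl⟩⟩ <;>
        exact Or.inr ⟨⟨_, rfl⟩, ⟨_, rfl⟩⟩
    · refine Or.inl (circle_eq_of_joined ⟨y, ?_⟩)
      rwa [← h y hyx]

/-- The circles of `s` arise from those of `t` by identifying the two different circles through the
arcs `p` and `q`. -/
structure Coarsens (D : PDCode N) (t s : Finset (Fin N)) (p q : Fin (2 * N)) : Prop where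
  of_eq : ∀ a b, D.circle t a = D.circle t b → D.circle s a = D.circle s b
  glue : D.circle s p = D.circle s q
  ne : D.circle t p ≠ D.circle t q
  fiber : ∀ a b, D.circle s a = D.circle s b → D.circle t a = D.circle t b ∨
    ((D.circle t a = D.circle t p ∨ D.circle t a = D.circle t q) ∧
      (D.circle t b = D.circle t p ∨ D.circle t b = D.circle t q))

namespace Coarsens

variable {s t : Finset (Fin N)} {p q : Fin (2 * N)}

theorem eq_glue_iff (h : D.Coarsens t s p q) (a : Fin (2 * N)) :
    D.circle s a = D.circle s p ↔ D.circle t a = D.circle t p ∨ D.circle t a = D.circle t q := by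
  constructor
  · intro ha
    rcases h.fiber _ _ ha with h | h
    · exact Or.inl h
    · exact h.1
  · rintro (ha | ha)
    · exact h.of_eq _ _ ha
    · exact (h.of_eq _ _ ha).trans h.glue.symm

theorem eq_iff_of_ne (h : D.Coarsens t s p q) {a b : Fin (2 * N)}
    (hp : D.circle t a ≠ D.circle t p) (hq : D.circle t a ≠ D.circle t q) :
    D.circle s a = D.circle s b ↔ D.circle t a = D.circle t b := by
  refine ⟨fun hab => ?_, h.of_eq a b⟩
  rcases h.fiber _ _ hab with h | h
  · exact h
  · exact absurd h.1 (by simp [hp, hq])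

/-- Away from the glued circles, the circles of `t` and `s` correspond bijectively. Constant
functions give the change in the number of circles; the signs turn the condition on quantum degrees
into a local one. -/
theorem sum_add (h : D.Coarsens t s p q) (f : D.Circle s → ℤ) (g : D.Circle t → ℤ)
    (hfg : ∀ a, D.circle t a ≠ D.circle t p → D.circle t a ≠ D.circle t q →
      g (D.circle t a) = f (D.circle s a)) :
    ∑ c, g c + f (D.circle s p) = ∑ c, f c + g (D.circle t p) + g (D.circle t q) := by
  classical
  have hq : D.circle t q ∈ Finset.univ.erase (D.circle t p) := by simp [h.ne.symm]
  rw [← Finset.add_sum_erase _ g (Finset.mem_univ (D.circle t p)), ← Finset.add_sum_erase _ g hq,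
    ← Finset.add_sum_erase _ f (Finset.mem_univ (D.circle s p))]
  have : ∑ c ∈ (Finset.univ.erase (D.circle t p)).erase (D.circle t q), g c =
      ∑ c ∈ Finset.univ.erase (D.circle s p), f c := by
    refine Finset.sum_bij (fun c _ => Quot.lift (D.circle s)
      (fun a b hab => h.of_eq a b (circle_eq_of_joined hab)) c) ?_ ?_ ?_ ?_
    · intro c hc
      obtain ⟨a, rfl⟩ := circle_surjective t c
      simp only [Finset.mem_erase, Finset.mem_univ, and_true] at hc ⊢
      exact fun ha => ((h.eq_glue_iff a).1 ha).elim hc.2 hc.1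
    · intro c hc c' hc' hcc
      obtain ⟨a, rfl⟩ := circle_surjective t c
      obtain ⟨b, rfl⟩ := circle_surjective t c'
      simp only [Finset.mem_erase, Finset.mem_univ, and_true] at hc
      exact (h.eq_iff_of_ne hc.2 hc.1).1 hcc
    · intro c hc
      obtain ⟨a, rfl⟩ := circle_surjective s c
      simp only [Finset.mem_erase, Finset.mem_univ, and_true] at hc
      rw [ne_eq, h.eq_glue_iff a, not_or] at hc
      exact ⟨D.circle t a, by simp [hc], rfl⟩
    · intro c hc
      obtain ⟨a, rfl⟩ := circle_surjective t c
      simp only [Finset.mem_erase, Finset.mem_univ, and_true] at hc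
      exact hfg a hc.2 hc.1
  rw [this]
  ring

theorem card_eq (h : D.Coarsens t s p q) :
    Fintype.card (D.Circle t) = Fintype.card (D.Circle s) + 1 := by
  have := h.sum_add (fun _ => 1) (fun _ => 1) (fun _ _ _ => rfl)
  simp at this
  omega

end Coarsens

/-- Changing the label of `x` turns the state `s` into `t` and splits a circle. -/
structure SplitsAt (D : PDCode N) (s t : Finset (Fin N)) (x : Fin N) : Prop where
  notMem : x ∉ s
  eq_insert : t = insert x s
  joined : D.circle s (D.arc x 0) = D.circle s (D.arc x 2)
  separated : D.circle t (D.arc x 0) ≠ D.circle t (D.arc x 1)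

/-- Changing the label of `x` turns the state `s` into `t` and merges two circles. -/
structure MergesAt (D : PDCode N) (s t : Finset (Fin N)) (x : Fin N) : Prop where
  notMem : x ∉ s
  eq_insert : t = insert x s
  separated : D.circle s (D.arc x 0) ≠ D.circle s (D.arc x 2)
  joined : D.circle t (D.arc x 0) = D.circle t (D.arc x 1)

theorem touch_of_mem {t : Finset (Fin N)} {x : Fin N} (hx : x ∈ t) (a : Fin (2 * N)) :
    (∃ k, D.circle t a = D.circle t (D.arc x k)) ↔
      D.circle t a = D.circle t (D.arc x 0) ∨ D.circle t a = D.circle t (D.arc x 1) := by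
  obtain ⟨h1, h2⟩ := circle_arc_of_mem (D := D) hx
  constructor
  · rintro ⟨k, hk⟩
    fin_cases k
    · exact Or.inl hk
    · exact Or.inr hk
    · exact Or.inr (hk.trans h2.symm)
    · exact Or.inl (hk.trans h1.symm)
  · rintro (h | h)
    exacts [⟨_, h⟩, ⟨_, h⟩]

theorem touch_of_notMem {t : Finset (Fin N)} {x : Fin N} (hx : x ∉ t) (a : Fin (2 * N)) :
    (∃ k, D.circle t a = D.circle t (D.arc x k)) ↔
      D.circle t a = D.circle t (D.arc x 0) ∨ D.circle t a = D.circle t (D.arc x 2) := by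
  obtain ⟨h1, h2⟩ := circle_arc_of_notMem (D := D) hx
  constructor
  · rintro ⟨k, hk⟩
    fin_cases k
    · exact Or.inl hk
    · exact Or.inl (hk.trans h1.symm)
    · exact Or.inr hk
    · exact Or.inr (hk.trans h2.symm)
  · rintro (h | h)
    exacts [⟨_, h⟩, ⟨_, h⟩]

variable {s t : Finset (Fin N)} {x : Fin N}

theorem SplitsAt.coarsens (h : D.SplitsAt s t x) : D.Coarsens t s (D.arc x 0) (D.arc x 1) := by
  obtain ⟨hx, ht, hj, hsep⟩ := h
  have hxt : x ∈ t := by simp [ht]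
  have hst : ∀ y, y ≠ x → (y ∈ s ↔ y ∈ t) := fun y hy => by simp [ht, hy]
  obtain ⟨h1, h2⟩ := circle_arc_of_notMem (D := D) hx
  refine ⟨fun a b hab => ?_, h1, hsep, fun a b hab => ?_⟩
  · rcases circle_eq_or_touch (fun y hy => (hst y hy).symm) hab with h | ⟨ha, hb⟩
    · exact h
    · rw [touch_of_notMem hx, ← hj, or_self] at ha hb
      exact ha.trans hb.symm
  · simpa only [touch_of_mem hxt] using circle_eq_or_touch hst hab

theorem MergesAt.coarsens (h : D.MergesAt s t x) : D.Coarsens s t (D.arc x 0) (D.arc x 2) := by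
  obtain ⟨hx, ht, hsep, hj⟩ := h
  have hxt : x ∈ t := by simp [ht]
  have hst : ∀ y, y ≠ x → (y ∈ s ↔ y ∈ t) := fun y hy => by simp [ht, hy]
  obtain ⟨h1, h2⟩ := circle_arc_of_mem (D := D) hxt
  refine ⟨fun a b hab => ?_, hj.trans h2, hsep, fun a b hab => ?_⟩
  · rcases circle_eq_or_touch hst hab with h | ⟨ha, hb⟩
    · exact h
    · rw [touch_of_mem hxt, ← hj, or_self] at ha hb
      exact ha.trans hb.symm
  · simpa only [touch_of_notMem hx] using
      circle_eq_or_touch (fun y hy => (hst y hy).symm) hab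

theorem quantumDegree_eq_iff (hx : x ∉ s) (ht : t = insert x s) (σ : D.Circle s → ℤˣ)
    (τ : D.Circle t → ℤˣ) :
    quantumDegree (⟨t, τ⟩ : D.EnhancedState) = quantumDegree (⟨s, σ⟩ : D.EnhancedState) ↔
      ∑ c, (τ c : ℤ) + 1 = ∑ c, (σ c : ℤ) := by
  have : t.card = s.card + 1 := by rw [ht, Finset.card_insert_of_notMem hx]
  simp only [quantumDegree, homDegree, theta, this]
  push_cast
  constructor <;> intro h <;> linarith

/-- The signs away from `x` cancel in the comparison of quantum degrees, leaving only the circles at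
`x`. The numerical equation encodes the comultiplication: `+` becomes `(+,-)` or `(-,+)`, and `-`
becomes `(-,-)`. The merging version encodes the multiplication, with no outcome for `(-,-)`. -/
theorem SplitsAt.adjacentAt_iff (h : D.SplitsAt s t x) (σ : D.Circle s → ℤˣ)
    (τ : D.Circle t → ℤˣ) :
    AdjacentAt (⟨s, σ⟩ : D.EnhancedState) ⟨t, τ⟩ x ↔
      (∀ a, D.circle t a ≠ D.circle t (D.arc x 0) → D.circle t a ≠ D.circle t (D.arc x 1) →
        τ (D.circle t a) = σ (D.circle s a)) ∧
      (τ (D.circle t (D.arc x 0)) : ℤ) + τ (D.circle t (D.arc x 1)) + 1 =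
        σ (D.circle s (D.arc x 0)) := by
  have hc := h.coarsens
  have key : ∀ a, (∀ k : Fin 4, D.circle s a ≠ D.circle s (D.arc x k)) ↔
      D.circle t a ≠ D.circle t (D.arc x 0) ∧ D.circle t a ≠ D.circle t (D.arc x 1) := by
    intro a
    have := touch_of_notMem (D := D) h.notMem a
    rw [← h.joined, or_self, hc.eq_glue_iff] at this
    rw [← not_or, ← this, not_exists]
  simp only [AdjacentAt, h.notMem, h.eq_insert.symm, not_false_eq_true, true_and,
    quantumDegree_eq_iff h.notMem h.eq_insert, key, and_imp]
  rw [and_comm]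
  refine and_congr_right fun hoff => ?_
  have := hc.sum_add (fun c => (σ c : ℤ)) (fun c => (τ c : ℤ))
    (fun a ha hb => by rw [hoff a ha hb])
  constructor <;> intro h <;> linarith

theorem MergesAt.adjacentAt_iff (h : D.MergesAt s t x) (σ : D.Circle s → ℤˣ)
    (τ : D.Circle t → ℤˣ) :
    AdjacentAt (⟨s, σ⟩ : D.EnhancedState) ⟨t, τ⟩ x ↔
      (∀ a, D.circle s a ≠ D.circle s (D.arc x 0) → D.circle s a ≠ D.circle s (D.arc x 2) →
        τ (D.circle t a) = σ (D.circle s a)) ∧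
      (σ (D.circle s (D.arc x 0)) : ℤ) + σ (D.circle s (D.arc x 2)) =
        τ (D.circle t (D.arc x 0)) + 1 := by
  have hc := h.coarsens
  have key : ∀ a, (∀ k : Fin 4, D.circle s a ≠ D.circle s (D.arc x k)) ↔
      D.circle s a ≠ D.circle s (D.arc x 0) ∧ D.circle s a ≠ D.circle s (D.arc x 2) := by
    intro a
    have := touch_of_notMem (D := D) h.notMem a
    rw [← not_or, ← this, not_exists]
  simp only [AdjacentAt, h.notMem, h.eq_insert.symm, not_false_eq_true, true_and,
    quantumDegree_eq_iff h.notMem h.eq_insert, key, and_imp]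
  rw [and_comm]
  refine and_congr_right fun hoff => ?_
  have := hc.sum_add (fun c => (τ c : ℤ)) (fun c => (σ c : ℤ))
    (fun a ha hb => by rw [hoff a ha hb])
  constructor <;> intro h <;> linarith

end PDCode

/-! ### Signs on circles under splits and merges, over the integers and modulo two. -/

namespace PDCode

open scoped Classical

variable {N : ℕ} {D : PDCode N} {s t : Finset (Fin N)} {x : Fin N}

/-- The number of circles with sign `-`. -/
noncomputable def negCount (τ : D.Circle s → ℤˣ) : ℕ :=
  (Finset.univ.filter (fun c => τ c = -1)).card

theorem sum_sign_eq (τ : D.Circle s → ℤˣ) :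
    ∑ c, (τ c : ℤ) = Fintype.card (D.Circle s) - 2 * negCount τ := by
  have : ∀ c, (τ c : ℤ) = 1 - 2 * if τ c = -1 then 1 else 0 := by
    intro c
    rcases Int.units_eq_one_or (τ c) with h | h <;> simp [h]
  simp only [this, Finset.sum_sub_distrib, ← Finset.mul_sum, negCount, Finset.card_filter]
  simp

/-- Adjacency lowers the sum of the signs by one. As a split creates a circle, the number of minus
signs must grow by one; a merge loses a circle, so there the number is unchanged. -/
theorem SplitsAt.sum_sign (h : D.SplitsAt s t x) {σ : D.Circle s → ℤˣ} {τ : D.Circle t → ℤˣ}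
    (hadj : AdjacentAt (⟨s, σ⟩ : D.EnhancedState) ⟨t, τ⟩ x) :
    negCount τ = negCount σ + 1 := by
  have h1 := (quantumDegree_eq_iff h.notMem h.eq_insert σ τ).1 hadj.2.2.1
  have h2 := h.coarsens.card_eq
  rw [sum_sign_eq, sum_sign_eq] at h1
  omega

theorem MergesAt.sum_sign (h : D.MergesAt s t x) {σ : D.Circle s → ℤˣ} {τ : D.Circle t → ℤˣ}
    (hadj : AdjacentAt (⟨s, σ⟩ : D.EnhancedState) ⟨t, τ⟩ x) :
    negCount τ = negCount σ := by
  have h1 := (quantumDegree_eq_iff h.notMem h.eq_insert σ τ).1 hadj.2.2.1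
  have h2 := h.coarsens.card_eq
  rw [sum_sign_eq, sum_sign_eq] at h1
  omega

/-- The signs which are `-` exactly on the circles of the set `A`. -/
noncomputable def minusOn (s : Finset (Fin N)) (A : Set (D.Circle s)) : D.Circle s → ℤˣ :=
  fun c => if c ∈ A then -1 else 1

theorem minusOn_eq_neg_one {A : Set (D.Circle s)} {c : D.Circle s} :
    minusOn s A c = -1 ↔ c ∈ A := by
  unfold minusOn
  split_ifs with h <;> simp [h]

theorem sign_ext {τ σ : ℤˣ} (h : τ = -1 ↔ σ = -1) : τ = σ := by
  rcases Int.units_eq_one_or τ with h1 | h1 <;> rcases Int.units_eq_one_or σ with h2 | h2 <;>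
    simp_all

theorem eq_minusOn_iff {A : Set (D.Circle s)} {τ : D.Circle s → ℤˣ} :
    τ = minusOn s A ↔ ∀ c, τ c = -1 ↔ c ∈ A := by
  constructor
  · rintro rfl c
    exact minusOn_eq_neg_one
  · exact fun h => funext fun c => sign_ext ((h c).trans minusOn_eq_neg_one.symm)

theorem negCount_minusOn_singleton (c : D.Circle s) : negCount (minusOn s {c}) = 1 := by
  simp only [negCount, minusOn_eq_neg_one, Set.mem_singleton_iff]
  exact Finset.card_eq_one.2 ⟨c, by ext; simp⟩

theorem sign_split_neg {a b c : ℤˣ} (h : (a : ℤ) + b + 1 = c) (hc : c = -1) : a = -1 ∧ b = -1 := by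
  subst hc
  rcases Int.units_eq_one_or a with h1 | h1 <;> rcases Int.units_eq_one_or b with h2 | h2 <;>
    simp_all

theorem sign_split_pos {a b c : ℤˣ} (h : (a : ℤ) + b + 1 = c) (hc : c ≠ -1) :
    (a = -1 ∧ b ≠ -1) ∨ (a ≠ -1 ∧ b = -1) := by
  rcases Int.units_eq_one_or a with h1 | h1 <;> rcases Int.units_eq_one_or b with h2 | h2 <;>
  rcases Int.units_eq_one_or c with h3 | h3 <;> simp_all

theorem SplitsAt.adjacentAt_plus_iff (h : D.SplitsAt s t x) (τ : D.Circle t → ℤˣ) :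
    AdjacentAt (⟨s, minusOn s ∅⟩ : D.EnhancedState) ⟨t, τ⟩ x ↔
      τ = minusOn t {D.circle t (D.arc x 0)} ∨ τ = minusOn t {D.circle t (D.arc x 1)} := by
  rw [h.adjacentAt_iff]
  have hsep := h.separated
  constructor
  · rintro ⟨hoff, hon⟩
    have hoff' : ∀ a, D.circle t a ≠ D.circle t (D.arc x 0) →
      D.circle t a ≠ D.circle t (D.arc x 1) → τ (D.circle t a) ≠ -1 := fun a h1 h2 => by
        rw [hoff a h1 h2]; simp [minusOn]
    rcases sign_split_pos hon (by simp [minusOn]) with ⟨h1, h2⟩ | ⟨h1, h2⟩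
    · refine Or.inl (eq_minusOn_iff.2 fun c => ?_)
      obtain ⟨a, rfl⟩ := circle_surjective t c
      have := hoff' a
      grind
    · refine Or.inr (eq_minusOn_iff.2 fun c => ?_)
      obtain ⟨a, rfl⟩ := circle_surjective t c
      have := hoff' a
      grind
  · rintro (rfl | rfl)
    · exact ⟨fun a h1 h2 => by simp [minusOn, h1], by simp [minusOn, hsep.symm]⟩
    · exact ⟨fun a h1 h2 => by simp [minusOn, h2], by simp [minusOn, hsep]⟩

/-- If the negative circle itself splits, both new circles are negative and one of them passes
through `b`. If it does not, it stays negative and one of the two new circles becomes negative. Both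
cases are described by one additional negative circle different from that of `b`, and this uniform
form is what telescopes. -/
theorem SplitsAt.adjacentAt_minus_iff (h : D.SplitsAt s t x) (b : Fin (2 * N))
    (τ : D.Circle t → ℤˣ) :
    AdjacentAt (⟨s, minusOn s {D.circle s b}⟩ : D.EnhancedState) ⟨t, τ⟩ x ↔
      (D.circle t (D.arc x 0) ≠ D.circle t b ∧
        τ = minusOn t {D.circle t b, D.circle t (D.arc x 0)}) ∨
      (D.circle t (D.arc x 1) ≠ D.circle t b ∧
        τ = minusOn t {D.circle t b, D.circle t (D.arc x 1)}) := by
  rw [h.adjacentAt_iff]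
  have hsep := h.separated
  have hglue := h.coarsens.eq_glue_iff b
  have hne := fun a => h.coarsens.eq_iff_of_ne (a := a) (b := b)
  constructor
  · rintro ⟨hoff, hon⟩
    have hoff' : ∀ a, D.circle t a ≠ D.circle t (D.arc x 0) →
      D.circle t a ≠ D.circle t (D.arc x 1) →
        (τ (D.circle t a) = -1 ↔ D.circle t a = D.circle t b) := fun a h1 h2 => by
        rw [hoff a h1 h2, minusOn_eq_neg_one, Set.mem_singleton_iff, hne a h1 h2]
    by_cases hb : D.circle s b = D.circle s (D.arc x 0)
    · obtain ⟨h1, h2⟩ := sign_split_neg hon (by simp [minusOn, hb])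
      rw [hglue] at hb
      rcases hb with hb | hb
      · refine Or.inr ⟨by rw [hb]; exact hsep.symm, eq_minusOn_iff.2 fun c => ?_⟩
        obtain ⟨a, rfl⟩ := circle_surjective t c
        have := hoff' a
        grind
      · refine Or.inl ⟨by rw [hb]; exact hsep, eq_minusOn_iff.2 fun c => ?_⟩
        obtain ⟨a, rfl⟩ := circle_surjective t c
        have := hoff' a
        grind
    · have hb' := hb
      rw [hglue, not_or] at hb'
      rcases sign_split_pos hon (by simp [minusOn, Ne.symm hb]) with ⟨h1, h2⟩ | ⟨h1, h2⟩
      · refine Or.inl ⟨Ne.symm hb'.1, eq_minusOn_iff.2 fun c => ?_⟩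
        obtain ⟨a, rfl⟩ := circle_surjective t c
        have := hoff' a
        grind
      · refine Or.inr ⟨Ne.symm hb'.2, eq_minusOn_iff.2 fun c => ?_⟩
        obtain ⟨a, rfl⟩ := circle_surjective t c
        have := hoff' a
        grind
  · have hoff : ∀ d, (d = D.circle t (D.arc x 0) ∨ d = D.circle t (D.arc x 1)) →
        ∀ a, D.circle t a ≠ D.circle t (D.arc x 0) → D.circle t a ≠ D.circle t (D.arc x 1) →
          minusOn t {D.circle t b, d} (D.circle t a) = minusOn s {D.circle s b} (D.circle s a) := by
      intro d hd a h1 h2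
      refine sign_ext ?_
      rw [minusOn_eq_neg_one, minusOn_eq_neg_one, Set.mem_singleton_iff, hne a h1 h2]
      simp only [Set.mem_insert_iff, Set.mem_singleton_iff]
      grind
    by_cases hb : D.circle s b = D.circle s (D.arc x 0)
    · rcases hglue.1 hb with hb' | hb'
      · rintro (⟨h1, rfl⟩ | ⟨h1, rfl⟩)
        · exact absurd hb'.symm h1
        · exact ⟨hoff _ (Or.inr rfl), by simp [minusOn, hb, hb']⟩
      · rintro (⟨h1, rfl⟩ | ⟨h1, rfl⟩)
        · exact ⟨hoff _ (Or.inl rfl), by simp [minusOn, hb, hb']⟩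
        · exact absurd hb'.symm h1
    · have hb' := hb
      rw [hglue, not_or] at hb'
      rintro (⟨h1, rfl⟩ | ⟨h1, rfl⟩)
      · exact ⟨hoff _ (Or.inl rfl), by
          simp [minusOn, Ne.symm hb, Ne.symm hb'.2, Ne.symm hb'.1, Ne.symm hsep]⟩
      · exact ⟨hoff _ (Or.inr rfl), by
          simp [minusOn, Ne.symm hb, Ne.symm hb'.2, Ne.symm hb'.1, hsep]⟩

theorem MergesAt.adjacentAt_minus_iff (h : D.MergesAt s t x) {b : Fin (2 * N)}
    (hb : D.circle t b = D.circle t (D.arc x 0)) (τ : D.Circle t → ℤˣ) :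
    AdjacentAt (⟨s, minusOn s {D.circle s b}⟩ : D.EnhancedState) ⟨t, τ⟩ x ↔
      τ = minusOn t {D.circle t b} := by
  rw [h.adjacentAt_iff]
  have hsep := h.separated
  have hglue := h.coarsens.eq_glue_iff
  have hb' := (hglue b).1 hb
  have hon : (minusOn s {D.circle s b} (D.circle s (D.arc x 0)) : ℤ) +
      minusOn s {D.circle s b} (D.circle s (D.arc x 2)) = 0 := by
    rcases hb' with hb' | hb' <;> simp [minusOn, hb', hsep, hsep.symm]
  have hoff : ∀ a, D.circle s a ≠ D.circle s (D.arc x 0) →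
      D.circle s a ≠ D.circle s (D.arc x 2) →
        minusOn s {D.circle s b} (D.circle s a) = 1 := by
    intro a h1 h2
    simp only [minusOn, Set.mem_singleton_iff, ite_eq_right_iff]
    grind
  rw [hon]
  constructor
  · rintro ⟨h1, h2⟩
    refine eq_minusOn_iff.2 fun c => ?_
    obtain ⟨a, rfl⟩ := circle_surjective t c
    rw [Set.mem_singleton_iff, hb]
    by_cases ha : D.circle t a = D.circle t (D.arc x 0)
    · rw [ha]
      rcases Int.units_eq_one_or (τ (D.circle t (D.arc x 0))) with h3 | h3
      · simp [h3] at h2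
      · simp [h3]
    · have ha' := ha
      rw [hglue, not_or] at ha'
      rw [h1 a ha'.1 ha'.2, hoff a ha'.1 ha'.2]
      simp [ha]
  · rintro rfl
    refine ⟨fun a h1 h2 => ?_, by simp [minusOn, hb]⟩
    rw [hoff a h1 h2]
    have := mt (hglue a).1 (by simp [h1, h2])
    simp [minusOn, hb, this]

/-- The number modulo two of enhancements `τ` with property `P` adjacent to `σ` is even when `P`
is invariant under exchanging the signs of the two new circles, and forces these to differ. -/
theorem SplitsAt.sum_adjacentAt_eq_zero (h : D.SplitsAt s t x) (σ : D.Circle s → ℤˣ)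
    (P : (D.Circle t → ℤˣ) → Prop) [DecidablePred P]
    (hP : ∀ τ, P τ → negCount τ = negCount σ + 1 →
      ¬ (τ (D.circle t (D.arc x 0)) = -1 ∧ τ (D.circle t (D.arc x 1)) = -1))
    (hswap : ∀ τ, negCount (τ ∘ Equiv.swap (D.circle t (D.arc x 0)) (D.circle t (D.arc x 1))) =
      negCount τ → P τ →
        P (τ ∘ Equiv.swap (D.circle t (D.arc x 0)) (D.circle t (D.arc x 1)))) :
    (∑ τ : D.Circle t → ℤˣ, if AdjacentAt (⟨s, σ⟩ : D.EnhancedState) ⟨t, τ⟩ x ∧ P τ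
      then (1 : ZMod 2) else 0) = 0 := by
  set p := D.circle t (D.arc x 0)
  set q := D.circle t (D.arc x 1)
  have hpq : p ≠ q := h.separated
  have key : ∀ τ, (AdjacentAt (⟨s, σ⟩ : D.EnhancedState) ⟨t, τ⟩ x ∧ P τ) →
      (AdjacentAt (⟨s, σ⟩ : D.EnhancedState) ⟨t, τ ∘ Equiv.swap p q⟩ x ∧
        P (τ ∘ Equiv.swap p q)) := by
    rintro τ ⟨h1, h2⟩
    have h3 : AdjacentAt (⟨s, σ⟩ : D.EnhancedState) ⟨t, τ ∘ Equiv.swap p q⟩ x := by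
      rw [h.adjacentAt_iff] at h1 ⊢
      refine ⟨fun a ha hb => ?_, ?_⟩
      · rw [← h1.1 a ha hb, Function.comp_apply, Equiv.swap_apply_of_ne_of_ne ha hb]
      · rw [← h1.2]
        simp only [Function.comp_apply]
        rw [Equiv.swap_apply_left, Equiv.swap_apply_right]
        change (τ q : ℤ) + τ p + 1 = τ p + τ q + 1
        ring
    exact ⟨h3, hswap τ ((h.sum_sign h3).trans (h.sum_sign h1).symm) h2⟩
  have hinv : ∀ τ : D.Circle t → ℤˣ, (τ ∘ Equiv.swap p q) ∘ Equiv.swap p q = τ := by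
    intro τ
    funext c
    simp
  refine Finset.sum_involution (fun τ _ => τ ∘ Equiv.swap p q) ?_ ?_ (fun _ _ => Finset.mem_univ _)
    (fun τ _ => hinv τ)
  · intro τ _
    by_cases h1 : AdjacentAt (⟨s, σ⟩ : D.EnhancedState) ⟨t, τ⟩ x ∧ P τ
    · rw [if_pos h1, if_pos (key τ h1)]
      decide
    · rw [if_neg h1, if_neg (fun h2 => h1 (by simpa only [hinv] using key _ h2))]
      decide
  -- A fixed point would give both new circles the same sign. Two plus signs violate the splitting
  -- rule, since $1+1+1$ is not a sign, and two minus signs are excluded by `hP`.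
  · intro τ _ h1 h2
    have h1 : AdjacentAt (⟨s, σ⟩ : D.EnhancedState) ⟨t, τ⟩ x ∧ P τ := by
      by_contra h3
      exact h1 (if_neg h3)
    have h3 : τ q = τ p := by simpa using congrFun h2 p
    have h4 := hP τ h1.2 (h.sum_sign h1.1)
    have h5 := ((h.adjacentAt_iff σ τ).1 h1.1).2
    change (τ p : ℤ) + τ q + 1 = _ at h5
    rw [h3, and_self] at h4
    change τ p ≠ -1 at h4
    rw [h3] at h5
    rcases Int.units_eq_one_or (τ p) with h6 | h6
    · rw [h6] at h5
      rcases Int.units_eq_one_or (σ (D.circle s (D.arc x 0))) with h7 | h7 <;>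
        rw [h7] at h5 <;> norm_num at h5
    · exact h4 h6

theorem SplitsAt.sum_adjacentAt_negCount_one (h : D.SplitsAt s t x) (σ : D.Circle s → ℤˣ) :
    (∑ τ : D.Circle t → ℤˣ, if AdjacentAt (⟨s, σ⟩ : D.EnhancedState) ⟨t, τ⟩ x ∧ negCount τ = 1
      then (1 : ZMod 2) else 0) = 0 := by
  refine h.sum_adjacentAt_eq_zero σ (fun τ => negCount τ = 1) (fun τ h1 _ => ?_) (fun τ h1 h2 => h1.trans h2)
  rintro ⟨h3, h4⟩
  exact h.separated (Finset.card_le_one.1 h1.le _ (by simpa using h3) _ (by simpa using h4))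

theorem SplitsAt.sum_adjacentAt_off (h : D.SplitsAt s t x) (σ : D.Circle s → ℤˣ)
    {b : Fin (2 * N)} (h0 : D.circle t b ≠ D.circle t (D.arc x 0))
    (h1 : D.circle t b ≠ D.circle t (D.arc x 1)) :
    (∑ τ : D.Circle t → ℤˣ, if AdjacentAt (⟨s, σ⟩ : D.EnhancedState) ⟨t, τ⟩ x ∧
      (τ (D.circle t b) = -1 ∧ negCount τ = 2) then (1 : ZMod 2) else 0) = 0 := by
  refine h.sum_adjacentAt_eq_zero σ (fun τ => τ (D.circle t b) = -1 ∧ negCount τ = 2) ?_ ?_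
  · rintro τ ⟨h2, h3⟩ _ ⟨h4, h5⟩
    have : ({D.circle t b, D.circle t (D.arc x 0), D.circle t (D.arc x 1)} :
        Finset (D.Circle t)) ⊆ Finset.univ.filter (fun c => τ c = -1) := by
      intro c
      simp only [Finset.mem_insert, Finset.mem_singleton, Finset.mem_filter, Finset.mem_univ,
        true_and]
      rintro (rfl | rfl | rfl) <;> assumption
    have := Finset.card_le_card this
    rw [Finset.card_eq_three.2 ⟨_, _, _, h0, h1, h.separated, rfl⟩] at this
    change 3 ≤ negCount τ at this
    omega
  · rintro τ h2 ⟨h3, h4⟩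
    refine ⟨?_, h2.trans h4⟩
    rwa [Function.comp_apply, Equiv.swap_apply_of_ne_of_ne h0 h1]

theorem sum_ite_eq_ite_of_existsUnique {α : Type*} [Fintype α] {P : α → Prop} [DecidablePred P]
    {Q : Prop} [Decidable Q]
    (h : Q → ∃! a, P a) (h' : ¬ Q → ∀ a, ¬ P a) :
    (∑ a, if P a then (1 : ZMod 2) else 0) = if Q then 1 else 0 := by
  by_cases hQ : Q
  · obtain ⟨a, ha, hu⟩ := h hQ
    rw [if_pos hQ, Finset.sum_eq_single a (fun b _ hb => if_neg fun hPb => hb (hu b hPb))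
      (fun h => absurd (Finset.mem_univ a) h), if_pos ha]
  · rw [if_neg hQ, Finset.sum_eq_zero fun a _ => if_neg (h' hQ a)]

/-- Once one new circle is required to be negative, the splitting rule forces the other to inherit
the sign of the circle that was split. So exactly one enhancement is possible, with one minus more
than `σ`. -/
theorem SplitsAt.sum_adjacentAt_on (h : D.SplitsAt s t x) (σ : D.Circle s → ℤˣ)
    {b : Fin (2 * N)}
    (hb : D.circle t b = D.circle t (D.arc x 0) ∨ D.circle t b = D.circle t (D.arc x 1)) :
    (∑ τ : D.Circle t → ℤˣ, if AdjacentAt (⟨s, σ⟩ : D.EnhancedState) ⟨t, τ⟩ x ∧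
      (τ (D.circle t b) = -1 ∧ negCount τ = 2) then (1 : ZMod 2) else 0) =
        if negCount σ = 1 then 1 else 0 := by
  have hc := h.coarsens
  have hsep := h.separated
  refine sum_ite_eq_ite_of_existsUnique (α := D.Circle t → ℤˣ) (fun hσ => ?_) fun hσ τ hτ => ?_
  · let τ : D.Circle t → ℤˣ := fun c => if c = D.circle t b then -1 else
      σ (Quot.lift (D.circle s) (fun a b hab => hc.of_eq a b (circle_eq_of_joined hab)) c)
    have hτ : ∀ a, D.circle t a ≠ D.circle t b → τ (D.circle t a) = σ (D.circle s a) :=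
      fun a ha => if_neg ha
    have hτb : τ (D.circle t b) = -1 := if_pos rfl
    have hadj : AdjacentAt (⟨s, σ⟩ : D.EnhancedState) ⟨t, τ⟩ x := by
      rw [h.adjacentAt_iff]
      refine ⟨fun a h0 h1 => hτ a ?_, ?_⟩
      · rcases hb with hb | hb <;> rwa [hb]
      · rcases hb with hb | hb
        · rw [← hb, hτb, hτ _ (by rw [hb]; exact hsep.symm), ← hc.glue]
          simp
        · rw [← hb, hτb, hτ _ (by rw [hb]; exact hsep)]
          simp
    refine ⟨τ, ⟨hadj, hτb, by rw [h.sum_sign hadj, hσ]⟩, ?_⟩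
    rintro τ' ⟨hadj', h3, -⟩
    rw [h.adjacentAt_iff] at hadj hadj'
    funext c
    obtain ⟨a, rfl⟩ := circle_surjective t c
    have e0 := hadj.2
    have e1 := hadj'.2
    rcases hb with hb | hb
    · by_cases ha : D.circle t a = D.circle t (D.arc x 0)
      · rw [ha, ← hb, h3, hτb]
      by_cases ha' : D.circle t a = D.circle t (D.arc x 1)
      · rw [← hb, hτb] at e0
        rw [← hb, h3] at e1
        rw [ha']
        exact Units.ext (by linarith)
      · rw [hadj.1 a ha ha', hadj'.1 a ha ha']
    · by_cases ha : D.circle t a = D.circle t (D.arc x 1)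
      · rw [ha, ← hb, h3, hτb]
      by_cases ha' : D.circle t a = D.circle t (D.arc x 0)
      · rw [← hb, hτb] at e0
        rw [← hb, h3] at e1
        rw [ha']
        exact Units.ext (by linarith)
      · rw [hadj.1 a ha' ha, hadj'.1 a ha' ha]
  · have := h.sum_sign hτ.1
    omega

theorem MergesAt.sum_adjacentAt (h : D.MergesAt s t x) (σ : D.Circle s → ℤˣ) :
    (∑ τ : D.Circle t → ℤˣ, if AdjacentAt (⟨s, σ⟩ : D.EnhancedState) ⟨t, τ⟩ x ∧
      negCount τ = 1 then (1 : ZMod 2) else 0) = if negCount σ = 1 then 1 else 0 := by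
  have hc := h.coarsens
  have hsep := h.separated
  refine sum_ite_eq_ite_of_existsUnique (α := D.Circle t → ℤˣ) (fun hσ => ?_) fun hσ τ hτ => ?_
  -- As `σ` has a single minus, the two merging circles are not both negative, and in the remaining
  -- cases the merging rule is the product of signs.
  · let τ : D.Circle t → ℤˣ := fun c => if c = D.circle t (D.arc x 0) then
      σ (D.circle s (D.arc x 0)) * σ (D.circle s (D.arc x 2)) else
      σ (D.circle s (Function.surjInv (circle_surjective t) c))
    have hτ0 : τ (D.circle t (D.arc x 0)) =
      σ (D.circle s (D.arc x 0)) * σ (D.circle s (D.arc x 2)) := if_pos rfl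
    have hnot : ¬ (σ (D.circle s (D.arc x 0)) = -1 ∧ σ (D.circle s (D.arc x 2)) = -1) := by
      rintro ⟨h3, h4⟩
      exact hsep (Finset.card_le_one.1 hσ.le _ (by simpa using h3) _ (by simpa using h4))
    have hadj : AdjacentAt (⟨s, σ⟩ : D.EnhancedState) ⟨t, τ⟩ x := by
      rw [h.adjacentAt_iff]
      refine ⟨fun a h0 h1 => ?_, ?_⟩
      · have hne : D.circle t a ≠ D.circle t (D.arc x 0) :=
          fun ha => ((hc.eq_glue_iff a).1 ha).elim h0 h1
        change (if _ then _ else _) = _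
        rw [if_neg hne]
        congr 1
        exact ((hc.eq_iff_of_ne h0 h1).1 (Function.surjInv_eq (circle_surjective t) _).symm).symm
      · rw [hτ0]
        rcases Int.units_eq_one_or (σ (D.circle s (D.arc x 0))) with h3 | h3 <;>
          rcases Int.units_eq_one_or (σ (D.circle s (D.arc x 2))) with h4 | h4 <;>
          simp_all
    refine ⟨τ, ⟨hadj, by rw [h.sum_sign hadj, hσ]⟩, ?_⟩
    rintro τ' ⟨hadj', -⟩
    rw [h.adjacentAt_iff] at hadj hadj'
    funext c
    obtain ⟨a, rfl⟩ := circle_surjective t c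
    by_cases ha : D.circle t a = D.circle t (D.arc x 0)
    · rw [ha]
      exact Units.ext (by linarith [hadj.2, hadj'.2])
    · have ha' := ha
      rw [hc.eq_glue_iff, not_or] at ha'
      rw [hadj.1 a ha'.1 ha'.2, hadj'.1 a ha'.1 ha'.2]
  · exact hσ ((h.sum_sign hτ.1).symm.trans hτ.2)

end PDCode

/-! ### Counting labels before a given position. -/

/-- The number of elements of `s` less than `n`. -/
def rank {N : ℕ} (s : Finset (Fin N)) (n : ℕ) : ℕ := (s.filter (fun y : Fin N => (y : ℕ) < n)).card

theorem rank_succ_of_mem {N : ℕ} {s : Finset (Fin N)} {x : Fin N} (h : x ∈ s) :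
    rank s (x + 1) = rank s x + 1 := by
  have : s.filter (fun y : Fin N => (y : ℕ) < x + 1) = insert x (s.filter (fun y : Fin N => (y : ℕ) < x)) := by
    ext y
    simp only [Finset.mem_filter, Finset.mem_insert, Fin.ext_iff]
    constructor
    · rintro ⟨h1, h2⟩
      by_cases h3 : (y : ℕ) = x
      · exact Or.inl h3
      · exact Or.inr ⟨h1, by omega⟩
    · rintro (h1 | ⟨h1, h2⟩)
      · exact ⟨by rwa [Fin.ext h1], by omega⟩
      · exact ⟨h1, by omega⟩
  rw [rank, this, Finset.card_insert_of_notMem (by simp), rank]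

theorem rank_succ_of_notMem {N : ℕ} {s : Finset (Fin N)} {x : Fin N} (h : x ∉ s) :
    rank s (x + 1) = rank s x := by
  unfold rank
  congr 1
  ext y
  simp only [Finset.mem_filter, and_congr_right_iff]
  intro hy
  have : (y : ℕ) ≠ x := fun h' => h (by rwa [← Fin.ext h'])
  omega

theorem rank_zero {N : ℕ} (s : Finset (Fin N)) : rank s 0 = 0 := by simp [rank]

theorem rank_mono {N : ℕ} (s : Finset (Fin N)) : Monotone (rank s) := fun _ _ h =>
  Finset.card_le_card (Finset.monotone_filter_right _ fun _ _ hy => lt_of_lt_of_le hy h)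

theorem rank_all {N : ℕ} (s : Finset (Fin N)) : rank s N = s.card := by
  rw [rank, Finset.filter_true_of_mem fun y _ => y.2]

theorem rank_lt_iff {N : ℕ} (s : Finset (Fin N)) {a b : ℕ} (hab : a ≤ b) :
    rank s a < rank s b ↔ ∃ x ∈ s, a ≤ (x : ℕ) ∧ (x : ℕ) < b := by
  have hsub : s.filter (fun y : Fin N => (y : ℕ) < a) ⊆ s.filter (fun y : Fin N => (y : ℕ) < b) :=
    Finset.monotone_filter_right _ fun _ _ hy => lt_of_lt_of_le hy hab
  constructor
  · intro h
    obtain ⟨x, h1, h2⟩ := Finset.exists_mem_notMem_of_card_lt_card h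
    simp only [Finset.mem_filter, not_and, not_lt] at h1 h2
    exact ⟨x, h1.1, h2 h1.1, h1.2⟩
  · rintro ⟨x, h1, h2, h3⟩
    refine Finset.card_lt_card (Finset.ssubset_iff_of_subset hsub |>.2 ⟨x, ?_, ?_⟩)
    · simp [h1, h3]
    · simp [h2]

theorem rank_insert {N : ℕ} {s : Finset (Fin N)} {x : Fin N} (h : x ∉ s) (n : ℕ) :
    rank (insert x s) n = rank s n + if (x : ℕ) < n then 1 else 0 := by
  unfold rank
  rw [Finset.filter_insert]
  split_ifs
  · rw [Finset.card_insert_of_notMem (by simp [h])]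
  · rfl

/-! ### Arcs and circles of the monocircular diagram. -/

namespace PDCode.Monocircular

variable {h₁ h₂ : ℕ}

theorem arcs_pos (hN : 0 < h₁ + h₂) (a : ℕ) : a % (2 * (h₁ + h₂)) < 2 * (h₁ + h₂) :=
  Nat.mod_lt _ (by omega)

variable (s : Finset (Fin (h₁ + h₂)))

/-- The circle of the state `s` of `D(h₁, h₂)` through the arc whose number is `a` modulo the number
of arcs. -/
def through (hN : 0 < h₁ + h₂) (a : ℕ) : (monocircular h₁ h₂).Circle s :=
  (monocircular h₁ h₂).circle s ⟨a % (2 * (h₁ + h₂)), arcs_pos hN a⟩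

variable (hN : 0 < h₁ + h₂)

theorem arc_left (j : Fin (h₁ + h₂)) (hj : (j : ℕ) < h₁) (k : Fin 4) :
    (monocircular h₁ h₂).arc j k = ⟨(![(j : ℕ) + 1, (j : ℕ), 2 * h₁ + h₂ - (j : ℕ),
      2 * h₁ + h₂ - ((j : ℕ) + 1)] k) % (2 * (h₁ + h₂)), arcs_pos j.pos _⟩ := by
  obtain ⟨i, rfl⟩ : ∃ i : Fin h₁, Fin.castAdd h₂ i = j := ⟨⟨j, hj⟩, rfl⟩
  simp [monocircular]

theorem arc_right (k : Fin (h₁ + h₂)) (hk : h₁ ≤ (k : ℕ)) (l : Fin 4) :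
    (monocircular h₁ h₂).arc k l = ⟨(![(k : ℕ), (k : ℕ) + 1,
      2 * h₁ + 2 * h₂ - ((k : ℕ) - h₁ + 1), 2 * h₁ + 2 * h₂ - ((k : ℕ) - h₁)] l) %
        (2 * (h₁ + h₂)), arcs_pos k.pos _⟩ := by
  obtain ⟨i, rfl⟩ : ∃ i : Fin h₂, Fin.natAdd h₁ i = k :=
    ⟨⟨k - h₁, by omega⟩, Fin.ext (by simp; omega)⟩
  simp [monocircular, Nat.add_assoc]

theorem through_arcs_left (j : Fin (h₁ + h₂)) (hj : (j : ℕ) < h₁) :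
    (monocircular h₁ h₂).circle s ((monocircular h₁ h₂).arc j 0) = through s hN (j + 1) ∧
    (monocircular h₁ h₂).circle s ((monocircular h₁ h₂).arc j 1) = through s hN j ∧
    (monocircular h₁ h₂).circle s ((monocircular h₁ h₂).arc j 2) =
      through s hN (2 * h₁ + h₂ - j) ∧
    (monocircular h₁ h₂).circle s ((monocircular h₁ h₂).arc j 3) =
      through s hN (2 * h₁ + h₂ - (j + 1)) := by
  simp [arc_left j hj, through]

/-- Here `k` is the number of the crossing in the whole diagram, so its step in $H_2$ is $k-h_1$ and
$Q_{k-h_1}$ has number $3h_1+2h_2-k$. Likewise $P_{k-h_1}$ has number $k$, so the arcs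
$0,\dots,h_1+h_2$ form a single path along both ladders. -/
theorem through_arcs_right (k : Fin (h₁ + h₂)) (hk : h₁ ≤ (k : ℕ)) :
    (monocircular h₁ h₂).circle s ((monocircular h₁ h₂).arc k 0) = through s hN k ∧
    (monocircular h₁ h₂).circle s ((monocircular h₁ h₂).arc k 1) = through s hN (k + 1) ∧
    (monocircular h₁ h₂).circle s ((monocircular h₁ h₂).arc k 2) =
      through s hN (3 * h₁ + 2 * h₂ - (k + 1)) ∧
    (monocircular h₁ h₂).circle s ((monocircular h₁ h₂).arc k 3) =
      through s hN (3 * h₁ + 2 * h₂ - k) := by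
  have h1 : 2 * h₁ + 2 * h₂ - ((k : ℕ) - h₁ + 1) = 3 * h₁ + 2 * h₂ - (k + 1) := by omega
  have h2 : 2 * h₁ + 2 * h₂ - ((k : ℕ) - h₁) = 3 * h₁ + 2 * h₂ - k := by omega
  simp [arc_right k hk, through, h1, h2]

theorem through_wrap : through s hN (2 * h₁ + 2 * h₂) = through s hN 0 := by
  simp [through, mul_add]

theorem through_succ {s} {x : Fin (h₁ + h₂)} (hx : x ∉ s) :
    through s hN (x + 1) = through s hN x := by
  obtain ⟨h, -⟩ := circle_arc_of_notMem (D := monocircular h₁ h₂) hx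
  rcases lt_or_ge (x : ℕ) h₁ with hxl | hxr
  · obtain ⟨e0, e1, -, -⟩ := through_arcs_left s hN x hxl
    rw [← e0, ← e1, h]
  · obtain ⟨e0, e1, -, -⟩ := through_arcs_right s hN x hxr
    rw [← e0, ← e1, h]

theorem through_eq_of_rank_eq {s} {a b : ℕ} (hab : a ≤ b) (hb : b ≤ h₁ + h₂)
    (h : rank s a = rank s b) : through s hN a = through s hN b := by
  induction b, hab using Nat.le_induction with
  | base => rfl
  | succ n hn ih =>
    have h1 := rank_mono s hn
    have h2 : rank s n ≤ rank s (n + 1) := rank_mono s (Nat.le_succ n)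
    have hx : (⟨n, by omega⟩ : Fin (h₁ + h₂)) ∉ s := fun hx => by
      have := rank_succ_of_mem hx
      simp at this
      omega
    rw [ih (by omega) (by omega)]
    exact (through_succ hN hx).symm

/-- An `A`-label continues each side of the ladder, and a `B`-label joins the two sides both before
and after the step. Either way, whether the two sides lie on one circle does not change along the
ladder. -/
theorem left_iff {s} (x : Fin (h₁ + h₂)) (hx : (x : ℕ) < h₁) :
    (through s hN (x + 1) = through s hN (2 * h₁ + h₂ - (x + 1)) ↔
      through s hN x = through s hN (2 * h₁ + h₂ - x)) ∧
    (x ∈ s → through s hN x = through s hN (2 * h₁ + h₂ - x)) := by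
  obtain ⟨e0, e1, e2, e3⟩ := through_arcs_left s hN x hx
  by_cases h : x ∈ s
  · obtain ⟨f, f'⟩ := circle_arc_of_mem (D := monocircular h₁ h₂) h
    rw [e0, e3] at f
    rw [e1, e2] at f'
    simp [f, f']
  · obtain ⟨f, f'⟩ := circle_arc_of_notMem (D := monocircular h₁ h₂) h
    rw [e0, e1] at f
    rw [e2, e3] at f'
    simp [f, f', h]

theorem right_iff {s} (x : Fin (h₁ + h₂)) (hx : h₁ ≤ (x : ℕ)) :
    (through s hN (x + 1) = through s hN (3 * h₁ + 2 * h₂ - (x + 1)) ↔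
      through s hN x = through s hN (3 * h₁ + 2 * h₂ - x)) ∧
    (x ∈ s → through s hN x = through s hN (3 * h₁ + 2 * h₂ - x)) := by
  obtain ⟨e0, e1, e2, e3⟩ := through_arcs_right s hN x hx
  by_cases h : x ∈ s
  · obtain ⟨f, f'⟩ := circle_arc_of_mem (D := monocircular h₁ h₂) h
    rw [e0, e3] at f
    rw [e1, e2] at f'
    simp [f, f']
  · obtain ⟨f, f'⟩ := circle_arc_of_notMem (D := monocircular h₁ h₂) h
    rw [e0, e1] at f
    rw [e2, e3] at f'
    simp [f, f', h]

theorem left_iff_zero {s} {j : ℕ} (hj : j ≤ h₁) :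
    through s hN j = through s hN (2 * h₁ + h₂ - j) ↔
      through s hN 0 = through s hN (2 * h₁ + h₂) := by
  induction j with
  | zero => simp
  | succ n ih => rw [← ih (by omega)]; exact (left_iff hN ⟨n, by omega⟩ hj).1

theorem right_iff_zero {s} {k : ℕ} (h : h₁ ≤ k) (hk : k ≤ h₁ + h₂) :
    through s hN k = through s hN (3 * h₁ + 2 * h₂ - k) ↔
      through s hN h₁ = through s hN 0 := by
  induction k, h using Nat.le_induction with
  | base =>
    rw [show 3 * h₁ + 2 * h₂ - h₁ = 2 * h₁ + 2 * h₂ by omega, through_wrap]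
  | succ n hn ih => rw [← ih (by omega)]; exact (right_iff hN ⟨n, by omega⟩ hn).1

/-- `s` has no `B`-label in the ladder `H₂`. -/
theorem through_bottom_right {s} (h : rank s h₁ = rank s (h₁ + h₂)) {k : ℕ} (hk : h₁ ≤ k)
    (hk' : k ≤ h₁ + h₂) : through s hN (3 * h₁ + 2 * h₂ - k) = through s hN 0 := by
  induction k, hk using Nat.le_induction with
  | base =>
    rw [show 3 * h₁ + 2 * h₂ - h₁ = 2 * h₁ + 2 * h₂ by omega, through_wrap]
  | succ n hn ih =>
    rw [← ih (by omega)]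
    have hx : (⟨n, by omega⟩ : Fin (h₁ + h₂)) ∉ s := fun hx =>
      ((rank_lt_iff s (by omega : h₁ ≤ h₁ + h₂)).2 ⟨_, hx, hn, by simp; omega⟩).ne h
    obtain ⟨-, -, e2, e3⟩ := through_arcs_right s hN ⟨n, by omega⟩ hn
    rw [← e2, ← e3]
    exact (circle_arc_of_notMem (D := monocircular h₁ h₂) hx).2

/-- It suffices that the two sides meet at one position. A `B`-label of $H_1$ joins them directly;
if $H_2$ has no `B`-label, the side $Q$ runs uninterrupted from $Q_0=U_0$ to $Q_{h_2}=L_0$. -/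
theorem left_glued {s} (h : 0 < rank s h₁ ∨ rank s h₁ = rank s (h₁ + h₂)) {j : ℕ}
    (hj : j ≤ h₁) : through s hN j = through s hN (2 * h₁ + h₂ - j) := by
  rcases h with h | h
  · obtain ⟨x, h1, -, h2⟩ := (rank_lt_iff s (Nat.zero_le h₁)).1 (by rwa [rank_zero])
    rw [left_iff_zero hN hj, ← left_iff_zero hN h2.le]
    exact (left_iff hN x h2).2 h1
  · rw [left_iff_zero hN hj]
    have := through_bottom_right hN h (k := h₁ + h₂) (by omega) le_rfl
    rw [← this]
    congr 1
    omega

theorem right_glued {s} (h : rank s h₁ < rank s (h₁ + h₂) ∨ rank s h₁ = 0) {k : ℕ}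
    (hk : h₁ ≤ k) (hk' : k ≤ h₁ + h₂) :
    through s hN k = through s hN (3 * h₁ + 2 * h₂ - k) := by
  rcases h with h | h
  · obtain ⟨x, h1, h2, h3⟩ := (rank_lt_iff s (Nat.le_add_right h₁ h₂)).1 h
    rw [right_iff_zero hN hk hk', ← right_iff_zero hN h2 h3.le]
    exact (right_iff hN x h2).2 h1
  · rw [right_iff_zero hN hk hk']
    exact (through_eq_of_rank_eq hN (Nat.zero_le _) (by omega) (by rw [h, rank_zero])).symm

/-- If both ladders have a `B`-label, then one circle passes through all four corners. -/
theorem through_corners {s} (h : 0 < rank s h₁) (h' : rank s h₁ < rank s (h₁ + h₂)) :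
    through s hN h₁ = through s hN 0 ∧ through s hN (h₁ + h₂) = through s hN 0 := by
  have a1 := left_glued hN (Or.inl h) (Nat.zero_le h₁)
  have a2 := left_glued hN (Or.inl h) le_rfl
  have a3 := right_glued hN (Or.inl h') le_rfl (Nat.le_add_right h₁ h₂)
  have a4 := right_glued hN (Or.inl h') (Nat.le_add_right h₁ h₂) le_rfl
  rw [show 3 * h₁ + 2 * h₂ - h₁ = 2 * h₁ + 2 * h₂ by omega, through_wrap] at a3
  rw [show 2 * h₁ + h₂ - h₁ = h₁ + h₂ by omega] at a2
  exact ⟨a3, by rw [← a2, a3]⟩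

/-- This yields invariants that separate circles: a function of arc numbers that respects every
smoothing is constant on circles. The condition `hwrap` is needed because $Q_0$ and $U_0$ are one
arc with the two numbers $2h_1+2h_2$ and $0$. -/
theorem joined_cases (s : Finset (Fin (h₁ + h₂))) {α : Type*} (f : ℕ → α)
    (hleft : ∀ j < h₁, ((∃ x ∈ s, (x : ℕ) = j) → f (j + 1) = f (2 * h₁ + h₂ - (j + 1)) ∧
        f j = f (2 * h₁ + h₂ - j)) ∧
      ((∀ x ∈ s, (x : ℕ) ≠ j) → f (j + 1) = f j ∧
        f (2 * h₁ + h₂ - j) = f (2 * h₁ + h₂ - (j + 1))))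
    (hright : ∀ k, h₁ ≤ k → k < h₁ + h₂ →
      ((∃ x ∈ s, (x : ℕ) = k) → f k = f (3 * h₁ + 2 * h₂ - k) ∧
        f (k + 1) = f (3 * h₁ + 2 * h₂ - (k + 1))) ∧
      ((∀ x ∈ s, (x : ℕ) ≠ k) → f k = f (k + 1) ∧
        f (3 * h₁ + 2 * h₂ - (k + 1)) = f (3 * h₁ + 2 * h₂ - k)))
    (hwrap : f (2 * h₁ + 2 * h₂) = f 0) {a b : ℕ} (ha : a < 2 * (h₁ + h₂))
    (hb : b < 2 * (h₁ + h₂)) (hab : through s hN a = through s hN b) : f a = f b := by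
  have hmod : ∀ n, n ≤ 2 * (h₁ + h₂) → f (n % (2 * (h₁ + h₂))) = f n := by
    intro n hn
    rcases hn.lt_or_eq with h | rfl
    · rw [Nat.mod_eq_of_lt h]
    · rw [Nat.mod_self, ← hwrap, mul_add]
  have := eq_of_circle_eq (D := monocircular h₁ h₂) (s := s) (fun e => f e) ?_ hab
  · simpa only [Nat.mod_eq_of_lt ha, Nat.mod_eq_of_lt hb] using this
  rintro c d ⟨x, hx⟩
  have hx' := x.2
  have hnot : x ∉ s → ∀ y ∈ s, (y : ℕ) ≠ x := fun h y hy h' => h (by rwa [← Fin.ext h'])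
  rcases lt_or_ge (x : ℕ) h₁ with hl | hr
  · obtain ⟨H1, H2⟩ := hleft x hl
    simp only [arc_left x hl] at hx
    rcases hx with ⟨hxs, ⟨rfl, rfl⟩ | ⟨rfl, rfl⟩⟩ | ⟨hxs, ⟨rfl, rfl⟩ | ⟨rfl, rfl⟩⟩ <;>
      dsimp <;> rw [hmod _ (by omega), hmod _ (by omega)]
    · exact (H2 (hnot hxs)).1
    · exact (H2 (hnot hxs)).2
    · exact (H1 ⟨x, hxs, rfl⟩).1
    · exact (H1 ⟨x, hxs, rfl⟩).2
  · obtain ⟨H1, H2⟩ := hright x hr hx'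
    simp only [arc_right x hr] at hx
    rw [show 2 * h₁ + 2 * h₂ - ((x : ℕ) - h₁ + 1) = 3 * h₁ + 2 * h₂ - (x + 1) by omega,
      show 2 * h₁ + 2 * h₂ - ((x : ℕ) - h₁) = 3 * h₁ + 2 * h₂ - x by omega] at hx
    rcases hx with ⟨hxs, ⟨rfl, rfl⟩ | ⟨rfl, rfl⟩⟩ | ⟨hxs, ⟨rfl, rfl⟩ | ⟨rfl, rfl⟩⟩ <;>
      dsimp <;> rw [hmod _ (by omega), hmod _ (by omega)]
    · exact (H2 (hnot hxs)).1
    · exact (H2 (hnot hxs)).2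
    · exact (H1 ⟨x, hxs, rfl⟩).1
    · exact (H1 ⟨x, hxs, rfl⟩).2

theorem rank_eq_of_forall_ne {n : ℕ} (hn : n < h₁ + h₂) (h : ∀ x ∈ s, (x : ℕ) ≠ n) :
    rank s (n + 1) = rank s n :=
  rank_succ_of_notMem (x := (⟨n, hn⟩ : Fin (h₁ + h₂))) fun hx => h _ hx rfl

/-- The numbers modulo `M` of the `B`-labels of `H₁` to the left of two arcs on a common circle
agree; for `M = 0` this needs that `H₂` has no `B`-label. -/
theorem left_count_eq {s} (M : ℕ) (hM : rank s h₁ = rank s (h₁ + h₂) ∨ M = rank s h₁) {a b : ℕ}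
    (ha : a < 2 * (h₁ + h₂)) (hb : b < 2 * (h₁ + h₂)) (hab : through s hN a = through s hN b)
    (cnt : ℕ → ℕ) (hcnt : cnt = fun a => if a ≤ h₁ then rank s a else if a ≤ h₁ + h₂ then
      rank s h₁ else if a ≤ 2 * h₁ + h₂ then rank s (2 * h₁ + h₂ - a) else 0) :
    (cnt a : ZMod M) = cnt b := by
  have c1 : ∀ j ≤ h₁, cnt j = rank s j := fun j hj => by simp [hcnt, hj]
  have c2 : ∀ j ≤ h₁, cnt (2 * h₁ + h₂ - j) = rank s j := fun j hj => by
    have e : 2 * h₁ + h₂ - (2 * h₁ + h₂ - j) = j := by omega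
    simp only [hcnt, e]
    split_ifs
    · congr 1; omega
    · congr 1; omega
    · rfl
    · omega
  have c3 : ∀ k, h₁ ≤ k → k ≤ h₁ + h₂ → cnt k = rank s h₁ := fun k hk hk' => by
    simp only [hcnt]
    split_ifs
    · congr 1; omega
    · rfl
  have c4 : ∀ k, h₁ ≤ k → k ≤ h₁ + h₂ → cnt (3 * h₁ + 2 * h₂ - k) = 0 := fun k hk hk' => by
    simp only [hcnt]
    split_ifs
    · rw [show 3 * h₁ + 2 * h₂ - k = 0 by omega, rank_zero]
    · have : h₁ = 0 := by omega
      subst this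
      exact rank_zero s
    · rw [show 2 * h₁ + h₂ - (3 * h₁ + 2 * h₂ - k) = 0 by omega, rank_zero]
    · rfl
  refine joined_cases hN s (fun a => (cnt a : ZMod M)) ?_ ?_ ?_ ha hb hab
  · intro j hj
    simp only [c1 j hj.le, c1 (j + 1) hj, c2 j hj.le, c2 (j + 1) hj]
    refine ⟨by simp, fun h => ?_⟩
    rw [rank_eq_of_forall_ne s (by omega) h]
    simp
  · intro k hk hk'
    simp only [c3 k hk hk'.le, c3 (k + 1) (by omega) hk', c4 k hk hk'.le,
      c4 (k + 1) (by omega) hk', Nat.cast_zero, and_self, imp_true_iff, and_true]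
    rintro ⟨x, hx, rfl⟩
    rcases hM with hM | hM
    · exact absurd hM ((rank_lt_iff s (by omega)).2 ⟨x, hx, hk, hk'⟩).ne
    · subst hM
      exact (ZMod.natCast_self _)
  · have := c4 h₁ le_rfl (by omega)
    rw [show 3 * h₁ + 2 * h₂ - h₁ = 2 * h₁ + 2 * h₂ by omega] at this
    simp only [this, c1 0 (Nat.zero_le _), rank_zero]

/-- The sides $U$ and $L$ carry the constant values $r$ and $r+n$, where $r$ and $n$ are the numbers
of `B`-labels in $H_1$ and $H_2$. A `B`-label of $H_1$ joins these sides, so the count survives only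
modulo $n$ unless $H_1$ is unlabelled. -/
theorem right_count_eq {s} (M : ℕ)
    (hM : rank s h₁ = 0 ∨ rank s (h₁ + h₂) = rank s h₁ + M) {a b : ℕ}
    (ha : a < 2 * (h₁ + h₂)) (hb : b < 2 * (h₁ + h₂)) (hab : through s hN a = through s hN b)
    (cnt : ℕ → ℕ) (hcnt : cnt = fun a => if a ≤ h₁ then rank s h₁ else if a ≤ h₁ + h₂ then
      rank s a else if a ≤ 2 * h₁ + h₂ then rank s (h₁ + h₂) else
        rank s (3 * h₁ + 2 * h₂ - a)) :
    (cnt a : ZMod M) = cnt b := by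
  have c1 : ∀ j ≤ h₁, cnt j = rank s h₁ := fun j hj => by simp [hcnt, hj]
  have c2 : ∀ j ≤ h₁, cnt (2 * h₁ + h₂ - j) = rank s (h₁ + h₂) := fun j hj => by
    simp only [hcnt]
    split_ifs
    · congr 1; omega
    · congr 1; omega
    · rfl
    · omega
  have c3 : ∀ k, h₁ ≤ k → k ≤ h₁ + h₂ → cnt k = rank s k := fun k hk hk' => by
    simp only [hcnt]
    split_ifs
    · congr 1; omega
    · rfl
  have c4 : ∀ k, h₁ ≤ k → k ≤ h₁ + h₂ → cnt (3 * h₁ + 2 * h₂ - k) = rank s k :=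
    fun k hk hk' => by
    have e : 3 * h₁ + 2 * h₂ - (3 * h₁ + 2 * h₂ - k) = k := by omega
    simp only [hcnt, e]
    split_ifs
    · congr 1; omega
    · congr 1; omega
    · congr 1; omega
    · rfl
  refine joined_cases hN s (fun a => (cnt a : ZMod M)) ?_ ?_ ?_ ha hb hab
  · intro j hj
    simp only [c1 j hj.le, c1 (j + 1) hj, c2 j hj.le, c2 (j + 1) hj, and_self, imp_true_iff,
      and_true]
    rintro ⟨x, hx, rfl⟩
    rcases hM with hM | hM
    · exact absurd ((rank_lt_iff s (Nat.zero_le h₁)).2 ⟨x, hx, Nat.zero_le _, hj⟩)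
        (by rw [hM, rank_zero]; exact lt_irrefl _)
    · simp [hM]
  · intro k hk hk'
    simp only [c3 k hk hk'.le, c3 (k + 1) (by omega) hk', c4 k hk hk'.le,
      c4 (k + 1) (by omega) hk', and_self, imp_true_iff, true_and]
    intro h
    rw [rank_eq_of_forall_ne s hk' h]
    exact ⟨rfl, rfl⟩
  · have := c4 h₁ le_rfl (by omega)
    rw [show 3 * h₁ + 2 * h₂ - h₁ = 2 * h₁ + 2 * h₂ by omega] at this
    simp only [this, c1 0 (Nat.zero_le _)]

end PDCode.Monocircular

/-! ### Which label changes split and which merge; numbers of circles. -/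

namespace PDCode.Monocircular

variable {h₁ h₂ : ℕ} (hN : 0 < h₁ + h₂) {s t : Finset (Fin (h₁ + h₂))} {x : Fin (h₁ + h₂)}


theorem left_rank_eq (M : ℕ) (hM : rank s h₁ = rank s (h₁ + h₂) ∨ M = rank s h₁) {a b : ℕ}
    (ha : a ≤ h₁) (hb : b ≤ h₁) (hab : through s hN a = through s hN b) :
    (rank s a : ZMod M) = rank s b := by
  have := left_count_eq hN M hM (by omega) (by omega) hab _ rfl
  simpa only [if_pos ha, if_pos hb] using this

theorem right_rank_eq (M : ℕ) (hM : rank s h₁ = 0 ∨ rank s (h₁ + h₂) = rank s h₁ + M) {a b : ℕ}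
    (ha : h₁ ≤ a) (ha' : a ≤ h₁ + h₂) (hb : h₁ ≤ b) (hb' : b ≤ h₁ + h₂)
    (hab : through s hN a = through s hN b) : (rank s a : ZMod M) = rank s b := by
  have := right_count_eq hN M hM (by omega) (by omega) hab _ rfl
  have h : ∀ c, h₁ ≤ c → c ≤ h₁ + h₂ → (if c ≤ h₁ then rank s h₁ else if c ≤ h₁ + h₂ then
      rank s c else if c ≤ 2 * h₁ + h₂ then rank s (h₁ + h₂) else
        rank s (3 * h₁ + 2 * h₂ - c)) = rank s c := fun c hc hc' => by
    split_ifs with h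
    · congr 1; omega
    · rfl
  rwa [h a ha ha', h b hb hb'] at this

theorem natCast_succ_ne {M : ℕ} (hM : M ≠ 1) (a : ℕ) : ((a + 1 : ℕ) : ZMod M) ≠ a := by
  rw [Nat.cast_add, ne_eq, add_eq_left, ZMod.natCast_eq_zero_iff, Nat.dvd_one]
  exact hM

/-- After the change the counts at the arcs $x$ and $x+1$ differ by one, which separates them unless
the modulus is $1$. The modulus is the new number of labels of $H_1$, at least two, or $0$ when
$H_2$ is unlabelled. -/
theorem splitsAt_left (hs : x ∉ s) (ht : t = insert x s) (hx : (x : ℕ) < h₁)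
    (h : 0 < rank s h₁ ∨ rank s h₁ = rank s (h₁ + h₂)) :
    (monocircular h₁ h₂).SplitsAt s t x := by
  have hxN := x.2
  obtain ⟨e0, -, e2, -⟩ := through_arcs_left s x.pos x hx
  obtain ⟨f0, f1, -, -⟩ := through_arcs_left t x.pos x hx
  refine ⟨hs, ht, ?_, ?_⟩
  · rw [e0, e2, through_succ _ hs, left_glued _ h hx.le]
  · rw [f0, f1]
    intro heq
    have r1 : rank t h₁ = rank s h₁ + 1 := by rw [ht, rank_insert hs, if_pos hx]
    have r2 : rank t (h₁ + h₂) = rank s (h₁ + h₂) + 1 := by rw [ht, rank_insert hs, if_pos hxN]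
    have hxt : x ∈ t := by simp [ht]
    rcases h with h | h
    · have := left_rank_eq x.pos _ (Or.inr rfl) hx hx.le heq
      rw [rank_succ_of_mem hxt] at this
      exact natCast_succ_ne (by omega) _ this
    · have := left_rank_eq x.pos 0 (Or.inl (by omega)) hx hx.le heq
      rw [rank_succ_of_mem hxt] at this
      exact natCast_succ_ne (by omega) _ this

theorem splitsAt_right (hs : x ∉ s) (ht : t = insert x s) (hx : h₁ ≤ (x : ℕ))
    (h : rank s h₁ < rank s (h₁ + h₂) ∨ rank s h₁ = 0) :
    (monocircular h₁ h₂).SplitsAt s t x := by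
  have hxN := x.2
  obtain ⟨e0, -, e2, -⟩ := through_arcs_right s x.pos x hx
  obtain ⟨f0, f1, -, -⟩ := through_arcs_right t x.pos x hx
  refine ⟨hs, ht, ?_, ?_⟩
  · rw [e0, e2, ← through_succ _ hs, right_glued _ h (k := x + 1) (by omega) hxN]
  · rw [f0, f1]
    intro heq
    have r1 : rank t h₁ = rank s h₁ := by rw [ht, rank_insert hs, if_neg (by omega), add_zero]
    have r2 : rank t (h₁ + h₂) = rank s (h₁ + h₂) + 1 := by rw [ht, rank_insert hs, if_pos hxN]
    have hxt : x ∈ t := by simp [ht]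
    rcases h with h | h
    · have := right_rank_eq x.pos (rank t (h₁ + h₂) - rank t h₁) (Or.inr (by omega)) hx hxN.le
        (by omega) hxN heq
      rw [rank_succ_of_mem hxt] at this
      exact natCast_succ_ne (by omega) _ this.symm
    · have := right_rank_eq x.pos 0 (Or.inl (by omega)) hx hxN.le (by omega) hxN heq
      rw [rank_succ_of_mem hxt] at this
      exact natCast_succ_ne (by omega) _ this.symm

/-- While $H_2$ is unlabelled, its sides lie on the circles through $U_{h_1}$ and $U_0$, which the
integral left count distinguishes. Afterwards both ladders are labelled and all corners share one
circle. -/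
theorem mergesAt_right (hs : x ∉ s) (ht : t = insert x s) (hx : h₁ ≤ (x : ℕ))
    (h : 0 < rank s h₁) (h' : rank s h₁ = rank s (h₁ + h₂)) :
    (monocircular h₁ h₂).MergesAt s t x := by
  have hxN := x.2
  have m1 := rank_mono s hx
  have m2 := rank_mono s hxN.le
  obtain ⟨e0, -, e2, -⟩ := through_arcs_right s x.pos x hx
  obtain ⟨f0, f1, -, -⟩ := through_arcs_right t x.pos x hx
  have r1 : rank t h₁ = rank s h₁ := by rw [ht, rank_insert hs, if_neg (by omega), add_zero]
  have r2 : rank t (h₁ + h₂) = rank s (h₁ + h₂) + 1 := by rw [ht, rank_insert hs, if_pos hxN]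
  have r3 : rank t x = rank s x := by rw [ht, rank_insert hs, if_neg (by omega), add_zero]
  have r4 : rank t (x + 1) = rank t x + 1 := rank_succ_of_mem (by simp [ht])
  refine ⟨hs, ht, ?_, ?_⟩
  · rw [e0, e2, through_bottom_right x.pos h' (k := x + 1) (by omega) hxN,
      ← through_eq_of_rank_eq x.pos hx hxN.le (by omega)]
    intro heq
    have := left_rank_eq x.pos 0 (Or.inl h') le_rfl (Nat.zero_le _) heq
    rw [rank_zero] at this
    -- `ZMod 0` is the ring of integers by definition, so nothing is lost by reduction.
    have : ((rank s h₁ : ℕ) : ℤ) = (0 : ℕ) := this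
    omega
  · obtain ⟨c1, c2⟩ := through_corners x.pos (s := t) (by omega) (by omega)
    rw [f0, f1, ← through_eq_of_rank_eq x.pos hx hxN.le (by omega),
      through_eq_of_rank_eq x.pos (a := (x : ℕ) + 1) hxN le_rfl (by omega), c1, c2]

theorem mergesAt_left (hs : x ∉ s) (ht : t = insert x s) (hx : (x : ℕ) < h₁)
    (h : rank s h₁ = 0) (h' : 0 < rank s (h₁ + h₂)) :
    (monocircular h₁ h₂).MergesAt s t x := by
  have hxN := x.2
  have m1 := rank_mono s hx.le
  obtain ⟨e0, -, e2, -⟩ := through_arcs_left s x.pos x hx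
  obtain ⟨f0, f1, -, -⟩ := through_arcs_left t x.pos x hx
  have r1 : rank t h₁ = rank s h₁ + 1 := by rw [ht, rank_insert hs, if_pos hx]
  have r2 : rank t (h₁ + h₂) = rank s (h₁ + h₂) + 1 := by rw [ht, rank_insert hs, if_pos hxN]
  have r3 : rank t x = rank s x := by rw [ht, rank_insert hs, if_neg (by omega), add_zero]
  have r4 : rank t (x + 1) = rank t x + 1 := rank_succ_of_mem (by simp [ht])
  refine ⟨hs, ht, ?_, ?_⟩
  · rw [e0, e2]
    intro heq
    -- For $x=0$ the opposite arc has number $2h_1+h_2$, which is below the number of arcs only if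
    -- $h_2>0$.
    have hh : 0 < h₂ := by
      rcases Nat.eq_zero_or_pos h₂ with rfl | h2
      · simp_all
      · exact h2
    have := right_count_eq x.pos 0 (Or.inl h) (by omega) (by omega) heq _ rfl
    rw [if_pos (by omega), if_neg (by omega), h] at this
    have key : ((0 : ℕ) : ZMod 0) = (rank s (h₁ + h₂) : ℕ) := by
      rw [this]
      split_ifs
      · congr 2; omega
      · rfl
      · omega
    have : ((0 : ℕ) : ℤ) = (rank s (h₁ + h₂) : ℕ) := key
    omega
  · obtain ⟨c1, c2⟩ := through_corners x.pos (s := t) (by omega) (by omega)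
    rw [f0, f1, through_eq_of_rank_eq x.pos (a := (x : ℕ) + 1) hx (by omega) (by omega),
      ← through_eq_of_rank_eq x.pos (Nat.zero_le _) hxN.le (by rw [rank_zero]; omega), c1]

theorem circle_eq_through (e : Fin (2 * (h₁ + h₂))) :
    (monocircular h₁ h₂).circle s e = through s hN e := by
  simp [through, Nat.mod_eq_of_lt e.2]

theorem card_circle_empty (hN : 0 < h₁ + h₂) :
    Fintype.card ((monocircular h₁ h₂).Circle (∅ : Finset (Fin (h₁ + h₂)))) = 1 := by
  have hr : ∀ n, rank (∅ : Finset (Fin (h₁ + h₂))) n = 0 := fun n => by simp [rank]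
  have htop : ∀ a ≤ h₁ + h₂, through ∅ hN a = through (∅ : Finset (Fin (h₁ + h₂))) hN 0 :=
    fun a ha => (through_eq_of_rank_eq hN (Nat.zero_le a) ha (by rw [hr, hr])).symm
  refine Fintype.card_eq_one_iff.2 ⟨through ∅ hN 0, fun c => ?_⟩
  obtain ⟨e, rfl⟩ := circle_surjective _ c
  rw [circle_eq_through hN]
  have he := e.2
  rcases le_or_gt (e : ℕ) (h₁ + h₂) with h | h
  · exact htop _ h
  rcases le_or_gt (e : ℕ) (2 * h₁ + h₂) with h' | h'
  · rw [← htop (2 * h₁ + h₂ - e) (by omega),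
      left_glued hN (Or.inr (by rw [hr, hr])) (j := 2 * h₁ + h₂ - e) (by omega)]
    congr 1
    omega
  · rw [← htop (3 * h₁ + 2 * h₂ - e) (by omega),
      right_glued hN (Or.inr (hr _)) (k := 3 * h₁ + 2 * h₂ - e) (by omega) (by omega)]
    congr 1
    omega

theorem rank_erase (hx : x ∈ t) (n : ℕ) :
    rank t n = rank (t.erase x) n + if (x : ℕ) < n then 1 else 0 := by
  rw [← rank_insert (Finset.notMem_erase x t), Finset.insert_erase hx]

/-- The number of circles of a state with `B`-labels in the first ladder only. -/
theorem card_circle_of_left (hN : 0 < h₁ + h₂) (h : rank s h₁ = rank s (h₁ + h₂)) :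
    Fintype.card ((monocircular h₁ h₂).Circle s) = rank s h₁ + 1 := by
  induction s using Finset.induction_on with
  | empty => rw [card_circle_empty hN]; simp [rank]
  | insert x s hx ih =>
    have hxN := x.2
    have hm := rank_mono s (Nat.le_add_right h₁ h₂)
    simp only [rank_insert hx, if_pos hxN] at h ⊢
    split_ifs at h ⊢ with hl
    · rw [← ih (by omega), (splitsAt_left hx rfl hl (Or.inr (by omega))).coarsens.card_eq]
    · omega

theorem card_circle_of_right (hN : 0 < h₁ + h₂) (h : rank s h₁ = 0) :
    Fintype.card ((monocircular h₁ h₂).Circle s) = rank s (h₁ + h₂) + 1 := by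
  induction s using Finset.induction_on with
  | empty => rw [card_circle_empty hN]; simp [rank]
  | insert x s hx ih =>
    have hxN := x.2
    simp only [rank_insert hx, if_pos hxN] at h ⊢
    split_ifs at h with hl
    rw [← ih (by omega),
      (splitsAt_right hx rfl (by omega) (Or.inr (by omega))).coarsens.card_eq]

/-- The number of circles of a state with `B`-labels in both ladders, just one of them in one of the
ladders. -/
theorem card_circle_of_both (hN : 0 < h₁ + h₂) {m₁ m₂ : ℕ} (h₁' : rank s h₁ = m₁)
    (h₂' : rank s (h₁ + h₂) = m₁ + m₂) (hm₁ : 1 ≤ m₁) (hm₂ : 1 ≤ m₂) (h : m₁ = 1 ∨ m₂ = 1) :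
    Fintype.card ((monocircular h₁ h₂).Circle s) + 1 = m₁ + m₂ := by
  rcases h with rfl | rfl
  -- Removing the only label of $H_1$ undoes a merge and leaves a state labelled in $H_2$ alone.
  · obtain ⟨x, hx, -, hxl⟩ := (rank_lt_iff s (Nat.zero_le h₁)).1 (by rw [rank_zero]; omega)
    have hxN := x.2
    have e1 := rank_erase hx h₁
    have e2 := rank_erase hx (h₁ + h₂)
    rw [if_pos hxl] at e1
    rw [if_pos hxN] at e2
    have := (mergesAt_left (Finset.notMem_erase x s) (Finset.insert_erase hx).symm hxl (by omega)
      (by omega)).coarsens.card_eq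
    rw [card_circle_of_right hN (by omega)] at this
    omega
  · obtain ⟨x, hx, hxr, hxN⟩ := (rank_lt_iff s (Nat.le_add_right h₁ h₂)).1 (by omega)
    have e1 := rank_erase hx h₁
    have e2 := rank_erase hx (h₁ + h₂)
    rw [if_neg (by omega)] at e1
    rw [if_pos hxN] at e2
    have := (mergesAt_right (Finset.notMem_erase x s) (Finset.insert_erase hx).symm hxr (by omega)
      (by omega)).coarsens.card_eq
    rw [card_circle_of_left hN (by omega)] at this
    omega

end PDCode.Monocircular

/-! ### The differential of a sum over states, and telescoping along a ladder. -/

namespace PDCode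

open scoped Classical

variable {N : ℕ} {D : PDCode N}

/-- The sum over the states `s` in `F` of the enhanced states given by the signs `z s`. -/
noncomputable def stateSum (D : PDCode N) (F : Finset (Finset (Fin N)))
    (z : ∀ s, D.Circle s → ℤˣ) : D.Chain ℤ :=
  ∑ s ∈ F, Pi.single (⟨s, z s⟩ : D.EnhancedState) 1

theorem stateSum_apply (F : Finset (Finset (Fin N))) (z : ∀ s, D.Circle s → ℤˣ)
    (t : Finset (Fin N)) (τ : D.Circle t → ℤˣ) :
    D.stateSum F z ⟨t, τ⟩ = if t ∈ F ∧ τ = z t then 1 else 0 := by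
  rw [stateSum, Finset.sum_apply]
  by_cases h : t ∈ F
  · rw [Finset.sum_eq_single t]
    · simp [Pi.single_apply, h]
    · intro s _ hs
      rw [Pi.single_apply, if_neg]
      intro h'
      exact hs (congrArg Sigma.fst h').symm
    · exact fun h' => absurd h h'
  · rw [if_neg (by simp [h]), Finset.sum_eq_zero]
    intro s hs
    rw [Pi.single_apply, if_neg]
    intro h'
    have : t = s := congrArg Sigma.fst h'
    exact h (this ▸ hs)

theorem AdjacentAt.eq_erase {S T : D.EnhancedState} {x : Fin N} (h : AdjacentAt S T x) :
    x ∈ T.1 ∧ S.1 = T.1.erase x := by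
  obtain ⟨h1, h2, -⟩ := h
  rw [h2]
  exact ⟨Finset.mem_insert_self _ _, (Finset.erase_insert h1).symm⟩

theorem rank_erase_self {t : Finset (Fin N)} {x : Fin N} : rank (t.erase x) x = rank t x := by
  unfold rank
  congr 1
  ext y
  simp only [Finset.mem_filter, Finset.mem_erase, ne_eq, and_congr_left_iff, and_iff_right_iff_imp]
  rintro hy - rfl
  exact lt_irrefl _ hy

theorem incidence_eq (S T : D.EnhancedState) :
    incidence S T = ∑ x : Fin N, if AdjacentAt S T x then (-1) ^ rank S.1 x else 0 := by
  refine Finset.sum_congr rfl fun x _ => ?_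
  split_ifs
  · unfold rank
    congr 2
  · rfl

theorem differential_apply (R : Type*) [CommRing R] (c : D.Chain R) (T : D.EnhancedState) :
    D.differential R c T = ∑ S, c S * (incidence S T : ℤ) := by
  simp [differential, Fintype.linearCombination_apply, Finset.sum_apply]

theorem differential_stateSum (F : Finset (Finset (Fin N))) (z : ∀ s, D.Circle s → ℤˣ)
    (t : Finset (Fin N)) (τ : D.Circle t → ℤˣ) :
    D.differential ℤ (D.stateSum F z) ⟨t, τ⟩ = ∑ x : Fin N, if x ∈ t ∧ t.erase x ∈ F ∧
      AdjacentAt (⟨t.erase x, z (t.erase x)⟩ : D.EnhancedState) ⟨t, τ⟩ x then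
        (-1) ^ rank t x else 0 := by
  have : D.differential ℤ (D.stateSum F z) ⟨t, τ⟩ =
      ∑ s ∈ F, incidence (⟨s, z s⟩ : D.EnhancedState) ⟨t, τ⟩ := by
    rw [stateSum, map_sum, Finset.sum_apply]
    refine Finset.sum_congr rfl fun s _ => ?_
    simp [differential_apply, Pi.single_apply]
  simp only [this, incidence_eq]
  rw [Finset.sum_comm]
  refine Finset.sum_congr rfl fun x _ => ?_
  by_cases h : x ∈ t ∧ t.erase x ∈ F
  · rw [Finset.sum_eq_single (t.erase x)]
    · simp [h.1, h.2, rank_erase_self]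
    · intro s _ hs
      rw [if_neg]
      exact fun h' => hs h'.eq_erase.2
    · exact fun h' => absurd h.2 h'
  · rw [if_neg (by tauto), Finset.sum_eq_zero]
    intro s hs
    rw [if_neg]
    intro h'
    obtain ⟨h1, h2⟩ := h'.eq_erase
    exact h ⟨h1, by rwa [← show s = t.erase x from h2]⟩

/-- The alternating sum over the steps of a ladder telescopes. -/
theorem sum_alternating (t : Finset (Fin N)) (f : ℕ → ℤ)
    (hf : ∀ x : Fin N, x ∉ t → f (x + 1) = f x) {a b : ℕ} (hab : a ≤ b) (hb : b ≤ N) :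
    (∑ x : Fin N, if x ∈ t ∧ a ≤ (x : ℕ) ∧ (x : ℕ) < b then
      (-1) ^ rank t x * (f x + f (x + 1)) else 0) =
      (-1) ^ rank t a * f a - (-1) ^ rank t b * f b := by
  -- At a labelled step the sign flips and the sum becomes a difference. At an unlabelled step
  -- neither sign nor `f` changes, so the difference is zero and the condition `x ∈ t` can be
  -- dropped.
  have h1 : ∀ x : Fin N, (if x ∈ t ∧ a ≤ (x : ℕ) ∧ (x : ℕ) < b then
      (-1) ^ rank t x * (f x + f (x + 1)) else 0) = (fun n : ℕ => if n ∈ Finset.Ico a b then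
        (-1) ^ rank t n * f n - (-1) ^ rank t (n + 1) * f (n + 1) else 0) x := by
    intro x
    simp only [Finset.mem_Ico]
    by_cases hx : x ∈ t
    · rw [rank_succ_of_mem hx, pow_succ]
      simp only [hx, true_and]
      split_ifs
      · ring
      · rfl
    · rw [rank_succ_of_notMem hx, hf x hx]
      simp [hx]
  rw [Finset.sum_congr rfl fun x _ => h1 x, Fin.sum_univ_eq_sum_range
    (fun n : ℕ => if n ∈ Finset.Ico a b then
        (-1) ^ rank t n * f n - (-1) ^ rank t (n + 1) * f (n + 1) else 0), ← Finset.sum_filter]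
  have h2 : (Finset.range N).filter (fun n => n ∈ Finset.Ico a b) = Finset.Ico a b := by
    ext n
    simp only [Finset.mem_filter, Finset.mem_range, Finset.mem_Ico]
    omega
  rw [h2]
  clear h1 h2 hb
  induction b, hab using Nat.le_induction with
  | base => simp
  | succ n hn ih => rw [Finset.sum_Ico_succ_top hn, ih]; ring

theorem minusOn_injective {t : Finset (Fin N)} {A B : Set (D.Circle t)}
    (h : minusOn t A = minusOn t B) : A = B := by
  ext c
  rw [← minusOn_eq_neg_one, h, minusOn_eq_neg_one]

variable {s t : Finset (Fin N)} {x : Fin N}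

theorem SplitsAt.ite_plus (h : D.SplitsAt s t x) (τ : D.Circle t → ℤˣ) :
    (if AdjacentAt (⟨s, minusOn s ∅⟩ : D.EnhancedState) ⟨t, τ⟩ x then (1 : ℤ) else 0) =
      (if τ = minusOn t {D.circle t (D.arc x 0)} then 1 else 0) +
      if τ = minusOn t {D.circle t (D.arc x 1)} then 1 else 0 := by
  rw [h.adjacentAt_plus_iff]
  by_cases h1 : τ = minusOn t {D.circle t (D.arc x 0)}
  · have h2 : ¬ τ = minusOn t {D.circle t (D.arc x 1)} := by
      rintro rfl
      exact h.separated (Set.singleton_injective (minusOn_injective h1)).symm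
    rw [if_pos (Or.inl h1), if_pos h1, if_neg h2, add_zero]
  · simp [h1]

theorem SplitsAt.ite_minus (h : D.SplitsAt s t x) (b : Fin (2 * N)) (τ : D.Circle t → ℤˣ) :
    (if AdjacentAt (⟨s, minusOn s {D.circle s b}⟩ : D.EnhancedState) ⟨t, τ⟩ x then (1 : ℤ)
      else 0) =
      (if D.circle t (D.arc x 0) ≠ D.circle t b ∧
        τ = minusOn t {D.circle t b, D.circle t (D.arc x 0)} then 1 else 0) +
      if D.circle t (D.arc x 1) ≠ D.circle t b ∧
        τ = minusOn t {D.circle t b, D.circle t (D.arc x 1)} then 1 else 0 := by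
  rw [h.adjacentAt_minus_iff]
  by_cases h1 : D.circle t (D.arc x 0) ≠ D.circle t b ∧
        τ = minusOn t {D.circle t b, D.circle t (D.arc x 0)}
  · have h2 : ¬ (D.circle t (D.arc x 1) ≠ D.circle t b ∧
        τ = minusOn t {D.circle t b, D.circle t (D.arc x 1)}) := by
      rintro ⟨h2, rfl⟩
      have := (Set.ext_iff.1 (minusOn_injective h1.2) (D.circle t (D.arc x 0))).2 (by simp)
      exact (Set.mem_insert_iff.1 this).elim h1.1 h.separated
    rw [if_pos (Or.inl h1), if_pos h1, if_neg h2, add_zero]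
  · simp [h1]

namespace Monocircular

variable {h₁ h₂ : ℕ}

/-- The states with `m₁` labels `B` in `H₁` and `m₂` in `H₂`. -/
noncomputable def statesOfType (h₁ h₂ m₁ m₂ : ℕ) : Finset (Finset (Fin (h₁ + h₂))) :=
  Finset.univ.filter fun s => rank s h₁ = m₁ ∧ rank s (h₁ + h₂) = m₁ + m₂

theorem mem_statesOfType {m₁ m₂ : ℕ} {s : Finset (Fin (h₁ + h₂))} :
    s ∈ statesOfType h₁ h₂ m₁ m₂ ↔ rank s h₁ = m₁ ∧ rank s (h₁ + h₂) = m₁ + m₂ := by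
  simp [statesOfType]

theorem ladderSum_eq (hN : 0 < h₁ + h₂) {m₁ m₂ a : ℕ} (ha : a < 2 * (h₁ + h₂)) :
    ladderSum h₁ h₂ m₁ m₂ a = (monocircular h₁ h₂).stateSum (statesOfType h₁ h₂ m₁ m₂)
      (fun s => minusOn s {through s hN a}) := by
  unfold ladderSum stateSum
  refine Finset.sum_congr ?_ fun s _ => ?_
  · ext s
    rw [mem_statesOfType, Finset.mem_filter, rank_all, rank]
    have := Finset.card_filter_add_card_filter_not (s := s)
      (fun x : Fin (h₁ + h₂) => (x : ℕ) < h₁)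
    simp only [not_lt] at this
    simp only [Finset.mem_univ, true_and]
    constructor <;> rintro ⟨h, h'⟩ <;> constructor <;> omega
  · congr 1
    unfold negAt minusOn
    congr 1
    funext c
    simp only [Set.mem_singleton_iff]
    congr 1
    refine propext ⟨?_, fun h => ⟨⟨a, ha⟩, rfl, ?_⟩⟩
    · rintro ⟨e, rfl, rfl⟩
      exact circle_eq_through hN e
    · rw [h, circle_eq_through hN]

section

variable {m₁ m₂ : ℕ} {t : Finset (Fin (h₁ + h₂))} {x : Fin (h₁ + h₂)}

theorem erase_left (hx : x ∈ t) (hl : (x : ℕ) < h₁)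
    (ht : t ∈ statesOfType h₁ h₂ (m₁ + 1) m₂) : t.erase x ∈ statesOfType h₁ h₂ m₁ m₂ := by
  have hxN := x.2
  have e1 := rank_erase hx h₁
  have e2 := rank_erase hx (h₁ + h₂)
  rw [if_pos hl] at e1
  rw [if_pos hxN] at e2
  rw [mem_statesOfType] at ht ⊢
  omega

theorem erase_right (hx : x ∈ t) (hr : h₁ ≤ (x : ℕ))
    (ht : t ∈ statesOfType h₁ h₂ m₁ (m₂ + 1)) : t.erase x ∈ statesOfType h₁ h₂ m₁ m₂ := by
  have hxN := x.2
  have e1 := rank_erase hx h₁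
  have e2 := rank_erase hx (h₁ + h₂)
  rw [if_neg (by omega)] at e1
  rw [if_pos hxN] at e2
  rw [mem_statesOfType] at ht ⊢
  omega

theorem of_erase (hx : x ∈ t) (ht : t.erase x ∈ statesOfType h₁ h₂ m₁ m₂) :
    ((x : ℕ) < h₁ ∧ t ∈ statesOfType h₁ h₂ (m₁ + 1) m₂) ∨
      (h₁ ≤ (x : ℕ) ∧ t ∈ statesOfType h₁ h₂ m₁ (m₂ + 1)) := by
  have hxN := x.2
  have e1 := rank_erase hx h₁
  have e2 := rank_erase hx (h₁ + h₂)
  rw [if_pos hxN] at e2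
  simp only [mem_statesOfType] at ht ⊢
  split_ifs at e1 with h
  · exact Or.inl (by omega)
  · exact Or.inr (by omega)

variable (z : ∀ s, (monocircular h₁ h₂).Circle s → ℤˣ) (τ : (monocircular h₁ h₂).Circle t → ℤˣ)

theorem differential_eq_zero_of_type (hl : t ∉ statesOfType h₁ h₂ (m₁ + 1) m₂)
    (hr : t ∉ statesOfType h₁ h₂ m₁ (m₂ + 1)) :
    (monocircular h₁ h₂).differential ℤ
      ((monocircular h₁ h₂).stateSum (statesOfType h₁ h₂ m₁ m₂) z) ⟨t, τ⟩ = 0 := by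
  rw [differential_stateSum]
  refine Finset.sum_eq_zero fun x _ => if_neg ?_
  rintro ⟨hx, hF, -⟩
  exact (of_erase hx hF).elim (fun h => hl h.2) (fun h => hr h.2)

/-- Counting labels shows that such a `t` is reached only through crossings of $H_1$. The value `f
n` is the contribution attached to the arc `n`; telescoping leaves the corners $0$ and $h_1$. -/
theorem differential_left (ht : t ∈ statesOfType h₁ h₂ (m₁ + 1) m₂) (f : ℕ → ℤ)
    (hf : ∀ x : Fin (h₁ + h₂), x ∉ t → f (x + 1) = f x)
    (hadj : ∀ x ∈ t, (x : ℕ) < h₁ → t.erase x ∈ statesOfType h₁ h₂ m₁ m₂ →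
      (if AdjacentAt (⟨t.erase x, z (t.erase x)⟩ : (monocircular h₁ h₂).EnhancedState) ⟨t, τ⟩ x
        then (1 : ℤ) else 0) = f x + f (x + 1)) :
    (monocircular h₁ h₂).differential ℤ
      ((monocircular h₁ h₂).stateSum (statesOfType h₁ h₂ m₁ m₂) z) ⟨t, τ⟩ =
        f 0 - (-1) ^ (m₁ + 1) * f h₁ := by
  have := sum_alternating t f hf (Nat.zero_le h₁) (Nat.le_add_right h₁ h₂)
  rw [rank_zero, (mem_statesOfType.1 ht).1, pow_zero, one_mul] at this
  rw [differential_stateSum, ← this]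
  refine Finset.sum_congr rfl fun x _ => ?_
  by_cases hx : x ∈ t ∧ (x : ℕ) < h₁
  · have hF := erase_left hx.1 hx.2 ht
    rw [if_pos (⟨hx.1, Nat.zero_le _, hx.2⟩ : _ ∧ _ ∧ _), ← hadj x hx.1 hx.2 hF]
    simp [hx.1, hF]
  · rw [if_neg, if_neg (by tauto)]
    rintro ⟨h1, h2, -⟩
    rcases of_erase h1 h2 with h | h
    · exact hx ⟨h1, h.1⟩
    · rw [mem_statesOfType] at ht h
      omega

theorem differential_right (ht : t ∈ statesOfType h₁ h₂ m₁ (m₂ + 1)) (f : ℕ → ℤ)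
    (hf : ∀ x : Fin (h₁ + h₂), x ∉ t → f (x + 1) = f x)
    (hadj : ∀ x ∈ t, h₁ ≤ (x : ℕ) → t.erase x ∈ statesOfType h₁ h₂ m₁ m₂ →
      (if AdjacentAt (⟨t.erase x, z (t.erase x)⟩ : (monocircular h₁ h₂).EnhancedState) ⟨t, τ⟩ x
        then (1 : ℤ) else 0) = f x + f (x + 1)) :
    (monocircular h₁ h₂).differential ℤ
      ((monocircular h₁ h₂).stateSum (statesOfType h₁ h₂ m₁ m₂) z) ⟨t, τ⟩ =
        (-1) ^ m₁ * f h₁ - (-1) ^ (m₁ + (m₂ + 1)) * f (h₁ + h₂) := by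
  have := sum_alternating t f hf (Nat.le_add_right h₁ h₂) le_rfl
  rw [(mem_statesOfType.1 ht).1, (mem_statesOfType.1 ht).2] at this
  rw [differential_stateSum, ← this]
  refine Finset.sum_congr rfl fun x _ => ?_
  by_cases hx : x ∈ t ∧ h₁ ≤ (x : ℕ)
  · have hF := erase_right hx.1 hx.2 ht
    rw [if_pos (⟨hx.1, hx.2, x.2⟩ : _ ∧ _ ∧ _), ← hadj x hx.1 hx.2 hF]
    simp [hx.1, hF]
  · rw [if_neg, if_neg (by tauto)]
    rintro ⟨h1, h2, -⟩
    rcases of_erase h1 h2 with h | h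
    · rw [mem_statesOfType] at ht h
      omega
    · exact hx ⟨h1, h.1⟩

end

end Monocircular

end PDCode

/-! ### The cycles, and chains that bound twice these cycles. -/

namespace PDCode.Monocircular

open scoped Classical

variable {h₁ h₂ : ℕ} (hN : 0 < h₁ + h₂) {s t : Finset (Fin (h₁ + h₂))} {x : Fin (h₁ + h₂)}

theorem ite_minus_through (h : (monocircular h₁ h₂).SplitsAt s t x) (b : ℕ)
    (τ : (monocircular h₁ h₂).Circle t → ℤˣ) :
    (if AdjacentAt (⟨s, minusOn s {through s hN b}⟩ : (monocircular h₁ h₂).EnhancedState) ⟨t, τ⟩ x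
      then (1 : ℤ) else 0) =
      (if through t hN x ≠ through t hN b ∧ τ = minusOn t {through t hN b, through t hN x}
        then 1 else 0) +
      if through t hN (x + 1) ≠ through t hN b ∧
        τ = minusOn t {through t hN b, through t hN (x + 1)} then 1 else 0 := by
  have := h.ite_minus ⟨b % _, arcs_pos hN b⟩ τ
  rcases lt_or_ge (x : ℕ) h₁ with hx | hx
  · obtain ⟨e0, e1, -⟩ := through_arcs_left t hN x hx
    rw [e0, e1] at this
    exact this.trans (add_comm _ _)
  · obtain ⟨e0, e1, -⟩ := through_arcs_right t hN x hx
    rw [e0, e1] at this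
    exact this

theorem ite_plus_through (h : (monocircular h₁ h₂).SplitsAt s t x)
    (τ : (monocircular h₁ h₂).Circle t → ℤˣ) :
    (if AdjacentAt (⟨s, minusOn s ∅⟩ : (monocircular h₁ h₂).EnhancedState) ⟨t, τ⟩ x
      then (1 : ℤ) else 0) =
      (if τ = minusOn t {through t hN x} then 1 else 0) +
      if τ = minusOn t {through t hN (x + 1)} then 1 else 0 := by
  have := h.ite_plus τ
  rcases lt_or_ge (x : ℕ) h₁ with hx | hx
  · obtain ⟨e0, e1, -⟩ := through_arcs_left t hN x hx
    rw [e0, e1] at this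
    exact this.trans (add_comm _ _)
  · obtain ⟨e0, e1, -⟩ := through_arcs_right t hN x hx
    rwa [e0, e1] at this

theorem splitsAt_erase_left (hx : x ∈ t) (hl : (x : ℕ) < h₁) {m₁ m₂ : ℕ}
    (h : t.erase x ∈ statesOfType h₁ h₂ m₁ m₂) (hm : 0 < m₁ ∨ m₂ = 0) :
    (monocircular h₁ h₂).SplitsAt (t.erase x) t x := by
  rw [mem_statesOfType] at h
  exact splitsAt_left (Finset.notMem_erase x t) (Finset.insert_erase hx).symm hl (by omega)

theorem splitsAt_erase_right (hx : x ∈ t) (hr : h₁ ≤ (x : ℕ)) {m₁ m₂ : ℕ}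
    (h : t.erase x ∈ statesOfType h₁ h₂ m₁ m₂) (hm : 0 < m₂ ∨ m₁ = 0) :
    (monocircular h₁ h₂).SplitsAt (t.erase x) t x := by
  rw [mem_statesOfType] at h
  exact splitsAt_right (Finset.notMem_erase x t) (Finset.insert_erase hx).symm hr (by omega)

theorem corners_of_type {m₁ m₂ : ℕ} (h : t ∈ statesOfType h₁ h₂ m₁ m₂) (hm₁ : 1 ≤ m₁)
    (hm₂ : 1 ≤ m₂) :
    through t hN h₁ = through t hN 0 ∧ through t hN (h₁ + h₂) = through t hN 0 := by
  rw [mem_statesOfType] at h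
  exact through_corners hN (by omega) (by omega)

/-- The sum over all states with `m₁` labels `B` in `H₁` and `m₂` in `H₂`, in which exactly the
circle through the arc number `b` has sign `-`. -/
noncomputable def minusSum (m₁ m₂ b : ℕ) : (monocircular h₁ h₂).Chain ℤ :=
  (monocircular h₁ h₂).stateSum (statesOfType h₁ h₂ m₁ m₂) fun s => minusOn s {through s hN b}

/-- The sum over all states with `m₁` labels `B` in `H₁` and `m₂` in `H₂`, in which all circles have
sign `+`. -/
noncomputable def plusSum (h₁ h₂ m₁ m₂ : ℕ) : (monocircular h₁ h₂).Chain ℤ :=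
  (monocircular h₁ h₂).stateSum (statesOfType h₁ h₂ m₁ m₂) fun s => minusOn s ∅

theorem minusSum_left (τ : (monocircular h₁ h₂).Circle t → ℤˣ) {m₁ m₂ : ℕ} (b : ℕ)
    (ht : t ∈ statesOfType h₁ h₂ (m₁ + 1) m₂) (hm : 0 < m₁ ∨ m₂ = 0) :
    (monocircular h₁ h₂).differential ℤ (minusSum hN m₁ m₂ b) ⟨t, τ⟩ =
      (if through t hN 0 ≠ through t hN b ∧ τ = minusOn t {through t hN b, through t hN 0}
        then 1 else 0) - (-1) ^ (m₁ + 1) *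
      if through t hN h₁ ≠ through t hN b ∧ τ = minusOn t {through t hN b, through t hN h₁}
        then 1 else 0 :=
  differential_left _ τ ht (fun n => if through t hN n ≠ through t hN b ∧
    τ = minusOn t {through t hN b, through t hN n} then 1 else 0)
    (fun x hx => by simp only [through_succ hN hx])
    fun x hx hl hF => ite_minus_through hN (splitsAt_erase_left hx hl hF hm) b τ

theorem minusSum_right (τ : (monocircular h₁ h₂).Circle t → ℤˣ) {m₁ m₂ : ℕ} (b : ℕ)
    (ht : t ∈ statesOfType h₁ h₂ m₁ (m₂ + 1)) (hm : 0 < m₂ ∨ m₁ = 0) :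
    (monocircular h₁ h₂).differential ℤ (minusSum hN m₁ m₂ b) ⟨t, τ⟩ =
      (-1) ^ m₁ * (if through t hN h₁ ≠ through t hN b ∧
        τ = minusOn t {through t hN b, through t hN h₁} then 1 else 0) -
      (-1) ^ (m₁ + (m₂ + 1)) * if through t hN (h₁ + h₂) ≠ through t hN b ∧
        τ = minusOn t {through t hN b, through t hN (h₁ + h₂)} then 1 else 0 :=
  differential_right _ τ ht (fun n => if through t hN n ≠ through t hN b ∧
    τ = minusOn t {through t hN b, through t hN n} then 1 else 0)
    (fun x hx => by simp only [through_succ hN hx])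
    fun x hx hl hF => ite_minus_through hN (splitsAt_erase_right hx hl hF hm) b τ

theorem plusSum_left (τ : (monocircular h₁ h₂).Circle t → ℤˣ) {m₁ m₂ : ℕ}
    (ht : t ∈ statesOfType h₁ h₂ (m₁ + 1) m₂) (hm : 0 < m₁ ∨ m₂ = 0) :
    (monocircular h₁ h₂).differential ℤ (plusSum h₁ h₂ m₁ m₂) ⟨t, τ⟩ =
      (if τ = minusOn t {through t hN 0} then 1 else 0) - (-1) ^ (m₁ + 1) *
      if τ = minusOn t {through t hN h₁} then 1 else 0 :=
  differential_left _ τ ht (fun n => if τ = minusOn t {through t hN n} then 1 else 0)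
    (fun x hx => by simp only [through_succ hN hx])
    fun x hx hl hF => ite_plus_through hN (splitsAt_erase_left hx hl hF hm) τ

theorem plusSum_right (τ : (monocircular h₁ h₂).Circle t → ℤˣ) {m₁ m₂ : ℕ}
    (ht : t ∈ statesOfType h₁ h₂ m₁ (m₂ + 1)) (hm : 0 < m₂ ∨ m₁ = 0) :
    (monocircular h₁ h₂).differential ℤ (plusSum h₁ h₂ m₁ m₂) ⟨t, τ⟩ =
      (-1) ^ m₁ * (if τ = minusOn t {through t hN h₁} then 1 else 0) -
      (-1) ^ (m₁ + (m₂ + 1)) * if τ = minusOn t {through t hN (h₁ + h₂)} then 1 else 0 :=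
  differential_right _ τ ht (fun n => if τ = minusOn t {through t hN n} then 1 else 0)
    (fun x hx => by simp only [through_succ hN hx])
    fun x hx hl hF => ite_plus_through hN (splitsAt_erase_right hx hl hF hm) τ

/-- With both ladders labelled all changes are splits. The corner terms left by telescoping would
make the corner circle negative, which it already is, so they vanish. -/
theorem minusSum_mem_cycles {m₁ m₂ : ℕ} (hm₁ : 1 ≤ m₁) (hm₂ : 1 ≤ m₂) :
    minusSum hN m₁ m₂ 0 ∈ (monocircular h₁ h₂).cycles ℤ := by
  rw [LinearMap.mem_ker]
  funext ⟨t, τ⟩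
  rw [Pi.zero_apply]
  by_cases hl : t ∈ statesOfType h₁ h₂ (m₁ + 1) m₂
  · rw [minusSum_left hN τ 0 hl (Or.inl hm₁), (corners_of_type hN hl (by omega) hm₂).1]
    simp
  by_cases hr : t ∈ statesOfType h₁ h₂ m₁ (m₂ + 1)
  · obtain ⟨c1, c2⟩ := corners_of_type hN hr hm₁ (by omega)
    rw [minusSum_right hN τ 0 hr (Or.inl hm₂), c1, c2]
    simp
  exact differential_eq_zero_of_type _ τ hl hr

theorem minusSum_apply {m₁ m₂ b : ℕ} (τ : (monocircular h₁ h₂).Circle t → ℤˣ) :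
    minusSum hN m₁ m₂ b ⟨t, τ⟩ =
      if t ∈ statesOfType h₁ h₂ m₁ m₂ ∧ τ = minusOn t {through t hN b} then 1 else 0 :=
  stateSum_apply _ _ t τ

theorem statesOfType_disjoint {m₁ m₂ n₁ n₂ : ℕ} (h : t ∈ statesOfType h₁ h₂ m₁ m₂)
    (h' : t ∈ statesOfType h₁ h₂ n₁ n₂) : m₁ = n₁ ∧ m₂ = n₂ := by
  rw [mem_statesOfType] at h h'
  omega

/-- Both corner terms put the minus on the same circle. In $H_1$ the parity makes them add up to
twice it; in $H_2$ the number of labels becomes $2$ and they cancel. -/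
theorem differential_plusSum_left {m₁ : ℕ} (hm₁ : 1 ≤ m₁) (hodd : Odd (m₁ + 1)) :
    (monocircular h₁ h₂).differential ℤ (plusSum h₁ h₂ m₁ 1) =
      (2 : ℤ) • minusSum hN (m₁ + 1) 1 0 := by
  funext ⟨t, τ⟩
  rw [Pi.smul_apply, minusSum_apply]
  by_cases hl : t ∈ statesOfType h₁ h₂ (m₁ + 1) 1
  · rw [plusSum_left hN τ hl (Or.inl hm₁), (corners_of_type hN hl (by omega) le_rfl).1,
      hodd.neg_one_pow]
    simp only [hl, true_and]
    split_ifs <;> rfl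
  rw [if_neg (by tauto)]
  by_cases hr : t ∈ statesOfType h₁ h₂ m₁ 2
  · obtain ⟨c1, c2⟩ := corners_of_type hN hr hm₁ (by omega)
    rw [plusSum_right hN τ hr (Or.inl one_pos), c1, c2, pow_add]
    simp
  exact differential_eq_zero_of_type _ τ hl hr

theorem differential_plusSum_right {m₂ : ℕ} (hm₂ : 1 ≤ m₂) (hodd : Odd (m₂ + 1)) :
    (monocircular h₁ h₂).differential ℤ (-plusSum h₁ h₂ 1 m₂) =
      (2 : ℤ) • minusSum hN 1 (m₂ + 1) 0 := by
  rw [map_neg]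
  funext ⟨t, τ⟩
  rw [Pi.smul_apply, minusSum_apply, Pi.neg_apply]
  by_cases hr : t ∈ statesOfType h₁ h₂ 1 (m₂ + 1)
  · obtain ⟨c1, c2⟩ := corners_of_type hN hr le_rfl (by omega)
    rw [plusSum_right hN τ hr (Or.inl hm₂), c1, c2, pow_add, hodd.neg_one_pow]
    simp only [hr, true_and]
    split_ifs <;> rfl
  rw [if_neg (by tauto)]
  by_cases hl : t ∈ statesOfType h₁ h₂ 2 m₂
  · rw [plusSum_left hN τ hl (Or.inl one_pos), (corners_of_type hN hl (by omega) hm₂).1]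
    simp
  exact neg_eq_zero.2 (differential_eq_zero_of_type _ τ hl hr)

theorem minusSum_merge (τ : (monocircular h₁ h₂).Circle t → ℤˣ) {b : ℕ}
    (hb : through t hN b = through t hN 0) (ht : t ∈ statesOfType h₁ h₂ 1 1) :
    (monocircular h₁ h₂).differential ℤ (minusSum hN 0 1 b) ⟨t, τ⟩ =
      if τ = minusOn t {through t hN 0} then 1 else 0 := by
  have ht' := mem_statesOfType.1 ht
  have hcor := corners_of_type hN ht le_rfl le_rfl
  set e : ℤ := if τ = minusOn t {through t hN 0} then 1 else 0
  -- Here the only label of $H_1$ in `t` contributes a single merge term `e`. The step function that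
  -- drops from `e` to `0` at that label writes it in the form `f x + f (x + 1)`.
  have := differential_left (fun s => minusOn s {through s hN b}) τ ht
    (fun n => if rank t n = 0 then e else 0) (fun x hx => by simp only [rank_succ_of_notMem hx]) ?_
  · rw [minusSum, this, rank_zero, ht'.1]
    simp
  · intro x hx hl hF
    have hm : (monocircular h₁ h₂).MergesAt (t.erase x) t x := by
      rw [mem_statesOfType] at hF
      exact mergesAt_left (Finset.notMem_erase x t) (Finset.insert_erase hx).symm hl hF.1
        (by omega)
    have h1 := rank_succ_of_mem hx
    have h2 : rank t (x + 1) ≤ rank t h₁ := rank_mono t hl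
    have h3 : through t hN 0 = through t hN x :=
      through_eq_of_rank_eq hN (Nat.zero_le _) x.2.le (by rw [rank_zero]; omega)
    obtain ⟨-, e1, -⟩ := through_arcs_left t hN x hl
    have := hm.adjacentAt_minus_iff (b := ⟨b % _, arcs_pos hN b⟩)
      (by rw [hm.joined, e1, ← h3]; exact hb) τ
    have h4 : (monocircular h₁ h₂).circle t ⟨b % _, arcs_pos hN b⟩ = through t hN 0 := hb
    rw [h4] at this
    have h5 : rank t x = 0 := by omega
    have h6 : ((if rank t x = 0 then e else 0) + if rank t (x + 1) = 0 then e else 0) = e := by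
      rw [if_pos h5, if_neg (by omega), add_zero]
    exact (if_congr this rfl rfl).trans h6.symm

/-- An all-plus chain of type $(0,1)$ cannot serve, because a first label in $H_1$ merges instead of
splitting. The negative circle is placed at either end of $H_2$: both choices merge to the same
state, while their splits in $H_2$ leave the same pair of negative circles with opposite signs. -/
theorem differential_minusSum_one :
    (monocircular h₁ h₂).differential ℤ (minusSum hN 0 1 0 + minusSum hN 0 1 (h₁ + h₂)) =
      (2 : ℤ) • minusSum hN 1 1 0 := by
  rw [map_add]
  funext ⟨t, τ⟩
  rw [Pi.smul_apply, minusSum_apply, Pi.add_apply]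
  by_cases hl : t ∈ statesOfType h₁ h₂ 1 1
  · obtain ⟨c1, c2⟩ := corners_of_type hN hl le_rfl le_rfl
    rw [minusSum_merge hN τ rfl hl, minusSum_merge hN τ c2 hl]
    simp only [hl, true_and]
    split_ifs <;> rfl
  rw [if_neg (by tauto)]
  by_cases hr : t ∈ statesOfType h₁ h₂ 0 2
  · have c1 : through t hN h₁ = through t hN 0 := by
      rw [mem_statesOfType] at hr
      exact (through_eq_of_rank_eq hN (Nat.zero_le _) (by omega) (by rw [rank_zero, hr.1])).symm
    rw [minusSum_right hN τ 0 hr (Or.inl one_pos), minusSum_right hN τ (h₁ + h₂) hr (Or.inl one_pos),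
      c1, Set.pair_comm (through t hN (h₁ + h₂))]
    by_cases hc : through t hN (h₁ + h₂) = through t hN 0
    · simp [hc]
    · simp [hc, Ne.symm hc]
  have := differential_eq_zero_of_type (fun s => minusOn s {through s hN 0}) τ hl hr
  have := differential_eq_zero_of_type (fun s => minusOn s {through s hN (h₁ + h₂)}) τ hl hr
  simp_all [minusSum]

theorem exists_differential_eq_two_smul {m₁ m₂ : ℕ} (hm₁ : Odd m₁) (hm₂ : Odd m₂)
    (h : m₁ = 1 ∨ m₂ = 1) :
    ∃ c, (monocircular h₁ h₂).differential ℤ c = (2 : ℤ) • minusSum hN m₁ m₂ 0 := by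
  by_cases h1 : m₁ = 1
  · by_cases h2 : m₂ = 1
    · exact ⟨_, by rw [h1, h2]; exact differential_minusSum_one hN⟩
    · obtain ⟨k, rfl⟩ : ∃ k, m₂ = k + 1 := ⟨m₂ - 1, by have := hm₂.pos; omega⟩
      exact ⟨_, by rw [h1]; exact differential_plusSum_right hN (by omega) hm₂⟩
  · obtain ⟨k, rfl⟩ : ∃ k, m₁ = k + 1 := ⟨m₁ - 1, by have := hm₁.pos; omega⟩
    rw [h.resolve_left h1]
    exact ⟨_, differential_plusSum_left hN (by omega) hm₁⟩

theorem minusSum_mem_chainsOfDegree {m₁ m₂ : ℕ} (hm₁ : 1 ≤ m₁) (hm₂ : 1 ≤ m₂)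
    (h : m₁ = 1 ∨ m₂ = 1) : minusSum hN m₁ m₂ 0 ∈ (monocircular h₁ h₂).chainsOfDegree ℤ
      (m₁ + m₂) (2 * (m₁ + m₂) - 3) := by
  rintro ⟨t, τ⟩ hne
  rw [minusSum_apply] at hne
  obtain ⟨ht, hτ⟩ : t ∈ statesOfType h₁ h₂ m₁ m₂ ∧ τ = minusOn t {through t hN 0} := by
    by_contra hc
    exact hne (if_neg hc)
  have ht' := mem_statesOfType.1 ht
  have hcard := card_circle_of_both hN ht'.1 ht'.2 hm₁ hm₂ h
  have e1 : homDegree (⟨t, τ⟩ : (monocircular h₁ h₂).EnhancedState) = m₁ + m₂ := by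
    rw [homDegree, ← rank_all, ht'.2, Nat.cast_add]
  refine ⟨e1, ?_⟩
  rw [quantumDegree, e1, theta]
  change _ + ∑ c, (τ c : ℤ) = _
  -- With $m_1+m_2-1$ circles, one of them negative, $\theta=m_1+m_2-3$.
  rw [sum_sign_eq, hτ, negCount_minusOn_singleton]
  push_cast
  omega

end PDCode.Monocircular

/-! ### Cochains modulo two. -/

namespace PDCode

open scoped Classical

variable {N : ℕ} {D : PDCode N}

/-- The reduction modulo two of the value of the cochain `w` on the chain `c`. -/
noncomputable def pairing (w : D.EnhancedState → ZMod 2) (c : D.Chain ℤ) : ZMod 2 :=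
  ∑ T, w T * (c T : ZMod 2)

theorem pairing_add_left (w w' : D.EnhancedState → ZMod 2) (c : D.Chain ℤ) :
    pairing (w + w') c = pairing w c + pairing w' c := by
  simp [pairing, add_mul, Finset.sum_add_distrib]

theorem pairing_zero_left (c : D.Chain ℤ) : pairing (0 : D.EnhancedState → ZMod 2) c = 0 := by
  simp [pairing]

theorem pairing_add (w : D.EnhancedState → ZMod 2) (c c' : D.Chain ℤ) :
    pairing w (c + c') = pairing w c + pairing w c' := by
  simp [pairing, mul_add, Finset.sum_add_distrib]

theorem pairing_neg (w : D.EnhancedState → ZMod 2) (c : D.Chain ℤ) :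
    pairing w (-c) = pairing w c := by
  simp [pairing, CharTwo.neg_eq]

theorem pairing_differential (w : D.EnhancedState → ZMod 2)
    (h : ∀ S : D.EnhancedState, pairing w (fun T => incidence S T) = 0) (c : D.Chain ℤ) :
    pairing w (D.differential ℤ c) = 0 := by
  have : pairing w (D.differential ℤ c) =
      ∑ S, (c S : ZMod 2) * pairing w (fun T => incidence S T) := by
    simp only [pairing, differential_apply, Finset.mul_sum, Int.cast_sum]
    rw [Finset.sum_comm]
    refine Finset.sum_congr rfl fun S _ => Finset.sum_congr rfl fun T _ => ?_
    push_cast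
    ring
  rw [this, Finset.sum_eq_zero fun S _ => by rw [h S, mul_zero]]

/-- The cochain which takes the value one on the enhancements of `t` with the property `P`. -/
noncomputable def indicatorOn (t : Finset (Fin N)) (P : (D.Circle t → ℤˣ) → Prop) :
    D.EnhancedState → ZMod 2 :=
  fun T => if ∃ τ, T = ⟨t, τ⟩ ∧ P τ then 1 else 0

theorem sum_enhancedState {α : Type*} [AddCommMonoid α] (f : D.EnhancedState → α) :
    ∑ T, f T = ∑ t, ∑ τ : D.Circle t → ℤˣ, f ⟨t, τ⟩ := by
  convert Fintype.sum_sigma f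

theorem pairing_indicatorOn (t : Finset (Fin N)) (P : (D.Circle t → ℤˣ) → Prop)
    (c : D.Chain ℤ) :
    pairing (indicatorOn t P) c = ∑ τ, if P τ then (c ⟨t, τ⟩ : ZMod 2) else 0 := by
  rw [pairing, sum_enhancedState, Finset.sum_eq_single t]
  · refine Finset.sum_congr rfl fun τ _ => ?_
    simp [indicatorOn]
  · intro s _ hs
    refine Finset.sum_eq_zero fun τ _ => ?_
    rw [indicatorOn, if_neg, zero_mul]
    rintro ⟨τ', h, -⟩
    exact hs (congrArg Sigma.fst h)
  · exact fun h => absurd (Finset.mem_univ t) h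

/-- Signs disappear modulo two, so the coboundary can be found one crossing at a time. The set `A`
collects the crossings at which it does not vanish, and there it is always the indicator of a single
minus on `t.erase x`. This common shape lets coboundaries supported on different `t` cancel. -/
theorem pairing_indicatorOn_incidence (t : Finset (Fin N)) (P : (D.Circle t → ℤˣ) → Prop)
    (A : Finset (Fin N)) (hA : A ⊆ t)
    (h : ∀ x ∈ t, ∀ σ : D.Circle (t.erase x) → ℤˣ, (∑ τ, if AdjacentAt
      (⟨t.erase x, σ⟩ : D.EnhancedState) ⟨t, τ⟩ x ∧ P τ then (1 : ZMod 2) else 0) =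
        if x ∈ A ∧ negCount σ = 1 then 1 else 0) (S : D.EnhancedState) :
    pairing (indicatorOn t P) (fun T => incidence S T) =
      ∑ x ∈ A, if S.1 = t.erase x ∧ negCount S.2 = 1 then 1 else 0 := by
  have h1 : ∀ x, (∑ τ, if AdjacentAt S ⟨t, τ⟩ x ∧ P τ then (1 : ZMod 2) else 0) =
      if x ∈ A then (if S.1 = t.erase x ∧ negCount S.2 = 1 then 1 else 0) else 0 := by
    intro x
    by_cases hx : x ∈ t ∧ S.1 = t.erase x
    · obtain ⟨s, σ⟩ := S
      obtain ⟨hx, rfl⟩ := hx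
      rw [h x hx σ, ite_and]
      simp
    · rw [Finset.sum_eq_zero fun τ _ => if_neg fun h' => hx h'.1.eq_erase]
      split_ifs with h2 h3
      · exact absurd ⟨hA h2, h3.1⟩ hx
      · rfl
      · rfl
  have h2 : ∀ τ : D.Circle t → ℤˣ, (if P τ then ((incidence S ⟨t, τ⟩ : ℤ) : ZMod 2) else 0) =
      ∑ x, if AdjacentAt S ⟨t, τ⟩ x ∧ P τ then (1 : ZMod 2) else 0 := by
    intro τ
    by_cases hP : P τ
    · simp only [hP, and_true, if_true, incidence_eq, Int.cast_sum]
      refine Finset.sum_congr rfl fun x _ => ?_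
      split_ifs
      · simp [CharTwo.neg_eq]
      · simp
    · simp [hP]
  rw [pairing_indicatorOn, Finset.sum_congr rfl fun τ _ => h2 τ, Finset.sum_comm,
    Finset.sum_congr rfl fun x _ => h1 x, Finset.sum_ite_mem, Finset.univ_inter]

end PDCode

theorem card_filter_Ico {N a b : ℕ} (hb : b ≤ N) :
    (Finset.univ.filter fun x : Fin N => a ≤ (x : ℕ) ∧ (x : ℕ) < b).card = b - a := by
  rw [← Nat.card_Ico, ← Finset.card_map Fin.valEmbedding]
  congr 1
  ext n
  simp only [Finset.mem_map, Finset.mem_filter, Finset.mem_univ, true_and, Fin.valEmbedding_apply,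
    Finset.mem_Ico]
  exact ⟨by rintro ⟨x, h, rfl⟩; exact h, fun h => ⟨⟨n, by omega⟩, h, rfl⟩⟩

theorem rank_filter {N : ℕ} (p : Fin N → Prop) [DecidablePred p] (n : ℕ) :
    rank (Finset.univ.filter p) n =
      (Finset.univ.filter fun x : Fin N => p x ∧ (x : ℕ) < n).card := by
  rw [rank, Finset.filter_filter]

/-! ### The detecting cocycle. -/

namespace PDCode.Monocircular

open scoped Classical

variable {h₁ h₂ m₁ m₂ : ℕ}

/-- The state in which the first `m` crossings of `H₁` are labelled `B`. -/
noncomputable def leftState (h₁ h₂ m : ℕ) : Finset (Fin (h₁ + h₂)) :=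
  Finset.univ.filter fun x => 0 ≤ (x : ℕ) ∧ (x : ℕ) < m

/-- The state in which the first `m` crossings of `H₂` are labelled `B`. -/
noncomputable def rightState (h₁ h₂ m : ℕ) : Finset (Fin (h₁ + h₂)) :=
  Finset.univ.filter fun x => h₁ ≤ (x : ℕ) ∧ (x : ℕ) < h₁ + m

/-- The state in which the first crossing of each ladder is labelled `A`, and the next `m₁`
crossings of `H₁` and the next `m₂` crossings of `H₂` are labelled `B`. -/
noncomputable def middleState (h₁ h₂ m₁ m₂ : ℕ) : Finset (Fin (h₁ + h₂)) :=
  Finset.univ.filter fun x => (1 ≤ (x : ℕ) ∧ (x : ℕ) < m₁ + 1) ∨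
    (h₁ + 1 ≤ (x : ℕ) ∧ (x : ℕ) < h₁ + m₂ + 1)

theorem leftState_mem {m : ℕ} (hm : m ≤ h₁) : leftState h₁ h₂ m ∈ statesOfType h₁ h₂ m 0 := by
  rw [mem_statesOfType, leftState, rank_filter, rank_filter]
  constructor <;> convert card_filter_Ico (N := h₁ + h₂) (a := 0) (b := m) (by omega) using 3 <;>
    omega

theorem rightState_mem {m : ℕ} (hm : m ≤ h₂) : rightState h₁ h₂ m ∈ statesOfType h₁ h₂ 0 m := by
  rw [mem_statesOfType, rightState, rank_filter, rank_filter]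
  constructor
  · rw [Finset.card_eq_zero, Finset.filter_eq_empty_iff]
    intro x _
    omega
  · convert card_filter_Ico (N := h₁ + h₂) (a := h₁) (b := h₁ + m) (by omega) using 3 <;> omega

theorem middleState_mem (hm₁ : m₁ < h₁) (hm₂ : m₂ < h₂) :
    middleState h₁ h₂ m₁ m₂ ∈ statesOfType h₁ h₂ m₁ m₂ := by
  have c1 := card_filter_Ico (N := h₁ + h₂) (a := 1) (b := m₁ + 1) (by omega)
  have c2 := card_filter_Ico (N := h₁ + h₂) (a := h₁ + 1) (b := h₁ + m₂ + 1) (by omega)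
  rw [mem_statesOfType, rank_all, middleState, rank_filter]
  constructor
  · refine Eq.trans ?_ (c1.trans (Nat.add_sub_cancel _ _))
    congr 2
    ext x
    omega
  · rw [Finset.filter_or, Finset.card_union_of_disjoint, c1, c2]
    · omega
    · rw [Finset.disjoint_filter]
      intro x _
      omega

/-- Every change leading to this state is a split. Only the one at crossing $0$ creates the circle
through arc $0$; for the others, exchanging the two new circles pairs off the enhancements. -/
theorem sum_adjacentAt_leftState (hN : 0 < h₁ + h₂) {m : ℕ} (hm : m < h₁) {x : Fin (h₁ + h₂)}
    (hx : x ∈ leftState h₁ h₂ (m + 1))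
    (σ : (monocircular h₁ h₂).Circle ((leftState h₁ h₂ (m + 1)).erase x) → ℤˣ) :
    (∑ τ, if AdjacentAt (⟨(leftState h₁ h₂ (m + 1)).erase x, σ⟩ :
      (monocircular h₁ h₂).EnhancedState) ⟨leftState h₁ h₂ (m + 1), τ⟩ x ∧
        (τ (through _ hN 0) = -1 ∧ negCount τ = 2) then (1 : ZMod 2) else 0) =
      if x ∈ ({⟨0, hN⟩} : Finset (Fin (h₁ + h₂))) ∧ negCount σ = 1 then 1 else 0 := by
  have hmem : leftState h₁ h₂ (m + 1) ∈ statesOfType h₁ h₂ (m + 1) 0 := leftState_mem hm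
  have hl : (x : ℕ) < h₁ := by
    simp only [leftState, Finset.mem_filter] at hx
    omega
  have hsplit := splitsAt_erase_left hx hl (erase_left hx hl hmem) (Or.inr rfl)
  obtain ⟨e0, e1, -⟩ := through_arcs_left (leftState h₁ h₂ (m + 1)) hN x hl
  by_cases h0 : x = ⟨0, hN⟩
  · have := hsplit.sum_adjacentAt_on σ (b := ⟨0 % _, arcs_pos hN 0⟩)
      (Or.inr (by rw [e1, h0]; rfl))
    simp only [h0, Finset.mem_singleton, true_and] at this ⊢
    convert this
    rfl
  · have hr : 0 < rank (leftState h₁ h₂ (m + 1)) x := by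
      rw [← rank_zero (leftState h₁ h₂ (m + 1)), rank_lt_iff _ (Nat.zero_le _)]
      refine ⟨⟨0, hN⟩, by simp [leftState], le_rfl, ?_⟩
      exact Nat.pos_of_ne_zero fun h => h0 (Fin.ext h)
    have hne : ∀ n ≤ h₁, (x : ℕ) ≤ n → through (leftState h₁ h₂ (m + 1)) hN 0 ≠ through _ hN n := by
      intro n hn hxn heq
      rw [mem_statesOfType] at hmem
      have h2 := left_rank_eq hN 0 (Or.inl (by omega)) (Nat.zero_le _) hn heq
      rw [rank_zero] at h2
      have h3 : ((0 : ℕ) : ℤ) = (rank (leftState h₁ h₂ (m + 1)) n : ℕ) := h2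
      have h4 : rank (leftState h₁ h₂ (m + 1)) x ≤ rank (leftState h₁ h₂ (m + 1)) n :=
        rank_mono _ hxn
      omega
    have := hsplit.sum_adjacentAt_off σ (b := ⟨0 % _, arcs_pos hN 0⟩)
      (by rw [e0]; exact hne _ hl (Nat.le_succ _)) (by rw [e1]; exact hne _ hl.le le_rfl)
    simp only [h0, Finset.mem_singleton, false_and, if_false]
    convert this
    rfl

theorem sum_adjacentAt_rightState (hN : 0 < h₁ + h₂) {m : ℕ} (hm : m < h₂) {x : Fin (h₁ + h₂)}
    (hx : x ∈ rightState h₁ h₂ (m + 1))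
    (σ : (monocircular h₁ h₂).Circle ((rightState h₁ h₂ (m + 1)).erase x) → ℤˣ) :
    (∑ τ, if AdjacentAt (⟨(rightState h₁ h₂ (m + 1)).erase x, σ⟩ :
      (monocircular h₁ h₂).EnhancedState) ⟨rightState h₁ h₂ (m + 1), τ⟩ x ∧
        (τ (through _ hN h₁) = -1 ∧ negCount τ = 2) then (1 : ZMod 2) else 0) =
      if x ∈ ({⟨h₁, by omega⟩} : Finset (Fin (h₁ + h₂))) ∧ negCount σ = 1 then 1 else 0 := by
  have hmem : rightState h₁ h₂ (m + 1) ∈ statesOfType h₁ h₂ 0 (m + 1) := rightState_mem hm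
  have hr : h₁ ≤ (x : ℕ) := by
    simp only [rightState, Finset.mem_filter] at hx
    omega
  have hxN := x.2
  have hsplit := splitsAt_erase_right hx hr (erase_right hx hr hmem) (Or.inr rfl)
  obtain ⟨e0, e1, -⟩ := through_arcs_right (rightState h₁ h₂ (m + 1)) hN x hr
  by_cases h0 : x = ⟨h₁, by omega⟩
  · have := hsplit.sum_adjacentAt_on σ (b := ⟨h₁ % _, arcs_pos hN h₁⟩)
      (Or.inl (by rw [e0, h0]; rfl))
    simp only [h0, Finset.mem_singleton, true_and] at this ⊢
    convert this
    rfl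
  · have hrk : rank (rightState h₁ h₂ (m + 1)) h₁ < rank (rightState h₁ h₂ (m + 1)) x := by
      rw [rank_lt_iff _ hr]
      refine ⟨⟨h₁, by omega⟩, by simp [rightState], le_rfl, ?_⟩
      exact lt_of_le_of_ne hr fun h => h0 (Fin.ext h.symm)
    have hne : ∀ n ≤ h₁ + h₂, (x : ℕ) ≤ n →
        through (rightState h₁ h₂ (m + 1)) hN h₁ ≠ through _ hN n := by
      intro n hn hxn heq
      rw [mem_statesOfType] at hmem
      have h2 := right_rank_eq hN 0 (Or.inl hmem.1) le_rfl (by omega) (by omega) hn heq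
      have h3 : (rank (rightState h₁ h₂ (m + 1)) h₁ : ℤ) =
        (rank (rightState h₁ h₂ (m + 1)) n : ℕ) := h2
      have h4 : rank (rightState h₁ h₂ (m + 1)) x ≤ rank (rightState h₁ h₂ (m + 1)) n :=
        rank_mono _ hxn
      omega
    have := hsplit.sum_adjacentAt_off σ (b := ⟨h₁ % _, arcs_pos hN h₁⟩)
      (by rw [e0]; exact hne _ hxN.le le_rfl) (by rw [e1]; exact hne _ hxN (Nat.le_succ _))
    simp only [h0, Finset.mem_singleton, false_and, if_false]
    convert this
    rfl

/-- The crossings whose `B`-labels in the state `middleState h₁ h₂ m₁ m₂` merge circles. -/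
noncomputable def mergingCrossings (hh₁ : 1 < h₁) (hh₂ : 1 < h₂) (m₁ m₂ : ℕ) :
    Finset (Fin (h₁ + h₂)) :=
  (if m₂ = 1 then {⟨h₁ + 1, by omega⟩} else ∅) ∪ (if m₁ = 1 then {⟨1, by omega⟩} else ∅)

theorem mem_mergingCrossings (hh₁ : 1 < h₁) (hh₂ : 1 < h₂) {x : Fin (h₁ + h₂)} :
    x ∈ mergingCrossings hh₁ hh₂ m₁ m₂ ↔
      (m₂ = 1 ∧ (x : ℕ) = h₁ + 1) ∨ (m₁ = 1 ∧ (x : ℕ) = 1) := by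
  unfold mergingCrossings
  split_ifs <;> simp_all [Fin.ext_iff]

/-- A split yields a single minus from no minus in two ways, hence evenly. A merge keeps the number
of minus signs, and occurs only at the sole label of a ladder. -/
theorem sum_adjacentAt_middleState (hm₁ : 1 ≤ m₁) (hm₁' : m₁ < h₁) (hm₂ : 1 ≤ m₂) (hm₂' : m₂ < h₂)
    {x : Fin (h₁ + h₂)} (hx : x ∈ middleState h₁ h₂ m₁ m₂)
    (σ : (monocircular h₁ h₂).Circle ((middleState h₁ h₂ m₁ m₂).erase x) → ℤˣ) :
    (∑ τ, if AdjacentAt (⟨(middleState h₁ h₂ m₁ m₂).erase x, σ⟩ :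
      (monocircular h₁ h₂).EnhancedState) ⟨middleState h₁ h₂ m₁ m₂, τ⟩ x ∧
        negCount τ = 1 then (1 : ZMod 2) else 0) =
      if x ∈ mergingCrossings (by omega : 1 < h₁) (by omega : 1 < h₂) m₁ m₂ ∧ negCount σ = 1
        then 1 else 0 := by
  have hmem := middleState_mem hm₁' hm₂'
  have hx' : (1 ≤ (x : ℕ) ∧ (x : ℕ) < m₁ + 1) ∨
    (h₁ + 1 ≤ (x : ℕ) ∧ (x : ℕ) < h₁ + m₂ + 1) := by simpa [middleState] using hx
  obtain ⟨k₁, rfl⟩ : ∃ k, m₁ = k + 1 := ⟨m₁ - 1, by omega⟩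
  obtain ⟨k₂, rfl⟩ : ∃ k, m₂ = k + 1 := ⟨m₂ - 1, by omega⟩
  simp only [mem_mergingCrossings]
  rcases lt_or_ge (x : ℕ) h₁ with hl | hr
  · have he := erase_left hx hl hmem
    rcases Nat.eq_zero_or_pos k₁ with rfl | hk
    · have hm := mergesAt_left (Finset.notMem_erase x _) (Finset.insert_erase hx).symm hl
        (mem_statesOfType.1 he).1 (by rw [(mem_statesOfType.1 he).2]; omega)
      have h1 : (k₂ + 1 = 1 ∧ (x : ℕ) = h₁ + 1) ∨ (0 + 1 = 1 ∧ (x : ℕ) = 1) := by omega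
      have := hm.sum_adjacentAt σ
      refine Eq.trans ?_ (if_congr (and_iff_right h1) rfl rfl).symm
      convert this
    · have h1 : ¬ ((k₂ + 1 = 1 ∧ (x : ℕ) = h₁ + 1) ∨ (k₁ + 1 = 1 ∧ (x : ℕ) = 1)) := by omega
      have := (splitsAt_erase_left hx hl he (Or.inl hk)).sum_adjacentAt_negCount_one σ
      simp only [h1, false_and, if_false]
      convert this
  · have he := erase_right hx hr hmem
    rcases Nat.eq_zero_or_pos k₂ with rfl | hk
    · have hm := mergesAt_right (Finset.notMem_erase x _) (Finset.insert_erase hx).symm hr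
        (by rw [(mem_statesOfType.1 he).1]; omega)
        ((mem_statesOfType.1 he).1.trans (mem_statesOfType.1 he).2.symm)
      have h1 : (0 + 1 = 1 ∧ (x : ℕ) = h₁ + 1) ∨ (k₁ + 1 = 1 ∧ (x : ℕ) = 1) := by omega
      have := hm.sum_adjacentAt σ
      refine Eq.trans ?_ (if_congr (and_iff_right h1) rfl rfl).symm
      convert this
    · have h1 : ¬ ((k₂ + 1 = 1 ∧ (x : ℕ) = h₁ + 1) ∨ (k₁ + 1 = 1 ∧ (x : ℕ) = 1)) := by omega
      have := (splitsAt_erase_right hx hr he (Or.inl hk)).sum_adjacentAt_negCount_one σ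
      simp only [h1, false_and, if_false]
      convert this

/-- A cocycle modulo two which detects the class of `minusSum hN m₁ m₂ 0`. -/
noncomputable def detector (hN : 0 < h₁ + h₂) (m₁ m₂ : ℕ) : (monocircular h₁ h₂).EnhancedState → ZMod 2 :=
  (if m₂ = 1 then indicatorOn (leftState h₁ h₂ (m₁ + 1))
    (fun τ => τ (through _ hN 0) = -1 ∧ negCount τ = 2) else 0) +
  indicatorOn (middleState h₁ h₂ m₁ m₂) (fun τ => negCount τ = 1) +
  (if m₁ = 1 then indicatorOn (rightState h₁ h₂ (m₂ + 1))
    (fun τ => τ (through _ hN h₁) = -1 ∧ negCount τ = 2) else 0)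

/-- This coincidence is why the middle state skips the first crossing of each ladder: the
compensating state fills in that crossing, for which $m_1<h_1$ leaves room. -/
theorem leftState_erase (hN : 0 < h₁ + h₂) (hm : m₁ < h₁) (hh₂ : 1 < h₂) :
    (leftState h₁ h₂ (m₁ + 1)).erase ⟨0, hN⟩ =
      (middleState h₁ h₂ m₁ 1).erase ⟨h₁ + 1, by omega⟩ := by
  ext x
  simp only [leftState, middleState, Finset.mem_erase, Finset.mem_filter, Finset.mem_univ,
    true_and, ne_eq, Fin.ext_iff]
  omega

theorem rightState_erase (hm : m₂ < h₂) (hh₁ : 1 < h₁) :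
    (rightState h₁ h₂ (m₂ + 1)).erase ⟨h₁, by omega⟩ =
      (middleState h₁ h₂ 1 m₂).erase ⟨1, by omega⟩ := by
  ext x
  simp only [rightState, middleState, Finset.mem_erase, Finset.mem_filter, Finset.mem_univ,
    true_and, ne_eq, Fin.ext_iff]
  omega

theorem pairing_detector_incidence (hN : 0 < h₁ + h₂) (hm₁ : 1 ≤ m₁) (hm₁' : m₁ < h₁) (hm₂ : 1 ≤ m₂) (hm₂' : m₂ < h₂)
    (S : (monocircular h₁ h₂).EnhancedState) :
    pairing (detector hN m₁ m₂) (fun T => incidence S T) = 0 := by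
  have p1 := pairing_indicatorOn_incidence (leftState h₁ h₂ (m₁ + 1))
    (fun τ => τ (through _ hN 0) = -1 ∧ negCount τ = 2) {⟨0, hN⟩} (by simp [leftState])
    (fun x hx σ => by convert sum_adjacentAt_leftState hN hm₁' hx σ) S
  have p2 := pairing_indicatorOn_incidence (middleState h₁ h₂ m₁ m₂) (fun τ => negCount τ = 1)
    (mergingCrossings (by omega : 1 < h₁) (by omega : 1 < h₂) m₁ m₂)
    (fun x hx => by
      rw [mem_mergingCrossings] at hx
      simp only [middleState, Finset.mem_filter, Finset.mem_univ, true_and]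
      omega)
    (fun x hx σ => by convert sum_adjacentAt_middleState hm₁ hm₁' hm₂ hm₂' hx σ) S
  have p3 := pairing_indicatorOn_incidence (rightState h₁ h₂ (m₂ + 1))
    (fun τ => τ (through _ hN h₁) = -1 ∧ negCount τ = 2) {⟨h₁, by omega⟩} (by simp [rightState])
    (fun x hx σ => by convert sum_adjacentAt_rightState hN hm₂' hx σ) S
  rw [Finset.sum_singleton] at p1 p3
  have hdisj : Disjoint (if m₂ = 1 then ({⟨h₁ + 1, by omega⟩} : Finset (Fin (h₁ + h₂))) else ∅)
      (if m₁ = 1 then {⟨1, by omega⟩} else ∅) := by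
    split_ifs <;> simp [Fin.ext_iff]
    omega
  rw [mergingCrossings, Finset.sum_union hdisj] at p2
  rw [detector, pairing_add_left, pairing_add_left, p2]
  have q1 : pairing (if m₂ = 1 then indicatorOn (leftState h₁ h₂ (m₁ + 1))
      (fun τ => τ (through _ hN 0) = -1 ∧ negCount τ = 2) else 0) (fun T => incidence S T) =
      ∑ x ∈ (if m₂ = 1 then ({⟨h₁ + 1, by omega⟩} : Finset (Fin (h₁ + h₂))) else ∅),
        if S.1 = (middleState h₁ h₂ m₁ m₂).erase x ∧ negCount S.2 = 1 then (1 : ZMod 2) else 0 := by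
    by_cases h : m₂ = 1
    · subst h
      rw [if_pos rfl, if_pos rfl, p1, Finset.sum_singleton, leftState_erase hN hm₁' hm₂']
    · rw [if_neg h, if_neg h, pairing_zero_left, Finset.sum_empty]
  have q3 : pairing (if m₁ = 1 then indicatorOn (rightState h₁ h₂ (m₂ + 1))
      (fun τ => τ (through _ hN h₁) = -1 ∧ negCount τ = 2) else 0) (fun T => incidence S T) =
      ∑ x ∈ (if m₁ = 1 then ({⟨1, by omega⟩} : Finset (Fin (h₁ + h₂))) else ∅),
        if S.1 = (middleState h₁ h₂ m₁ m₂).erase x ∧ negCount S.2 = 1 then (1 : ZMod 2) else 0 := by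
    by_cases h : m₁ = 1
    · subst h
      rw [if_pos rfl, if_pos rfl, p3, Finset.sum_singleton, rightState_erase hm₂' hm₁']
    · rw [if_neg h, if_neg h, pairing_zero_left, Finset.sum_empty]
  -- Each merge contribution of the middle state occurs once more in a correction term.
  rw [q1, q3, ← add_assoc, CharTwo.add_self_eq_zero, zero_add, CharTwo.add_self_eq_zero]

theorem pairing_indicatorOn_minusSum_of_notMem (hN : 0 < h₁ + h₂) {t : Finset (Fin (h₁ + h₂))}
    (P : ((monocircular h₁ h₂).Circle t → ℤˣ) → Prop) {b : ℕ}
    (ht : t ∉ statesOfType h₁ h₂ m₁ m₂) :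
    pairing (indicatorOn t P) (minusSum hN m₁ m₂ b) = 0 := by
  rw [pairing_indicatorOn]
  refine Finset.sum_eq_zero fun τ _ => ?_
  have : minusSum hN m₁ m₂ b ⟨t, τ⟩ = 0 := by
    rw [minusSum_apply]
    exact if_neg fun h => ht h.1
  rw [this, Int.cast_zero, ite_self]

/-- The correction terms live on states with an unlabelled ladder, which do not occur in the chain.
The middle term sees at most one summand, and only when the types agree. -/
theorem pairing_detector_minusSum (hN : 0 < h₁ + h₂) {n₁ n₂ : ℕ} (hn₁ : 1 ≤ n₁) (hn₂ : 1 ≤ n₂) (hm₁ : m₁ < h₁)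
    (hm₂ : m₂ < h₂) :
    pairing (detector hN m₁ m₂) (minusSum hN n₁ n₂ 0) =
      if m₁ = n₁ ∧ m₂ = n₂ then 1 else 0 := by
  have q1 : pairing (if m₂ = 1 then indicatorOn (leftState h₁ h₂ (m₁ + 1))
      (fun τ => τ (through _ hN 0) = -1 ∧ negCount τ = 2) else 0) (minusSum hN n₁ n₂ 0) = 0 := by
    split_ifs
    · refine pairing_indicatorOn_minusSum_of_notMem hN _ fun h => ?_
      have := statesOfType_disjoint h (leftState_mem hm₁)
      omega
    · exact pairing_zero_left _
  have q3 : pairing (if m₁ = 1 then indicatorOn (rightState h₁ h₂ (m₂ + 1))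
      (fun τ => τ (through _ hN h₁) = -1 ∧ negCount τ = 2) else 0) (minusSum hN n₁ n₂ 0) = 0 := by
    split_ifs
    · refine pairing_indicatorOn_minusSum_of_notMem hN _ fun h => ?_
      have := statesOfType_disjoint h (rightState_mem hm₂)
      omega
    · exact pairing_zero_left _
  rw [detector, pairing_add_left, pairing_add_left, q1, q3, zero_add, add_zero]
  by_cases h : middleState h₁ h₂ m₁ m₂ ∈ statesOfType h₁ h₂ n₁ n₂
  · rw [if_pos (statesOfType_disjoint (middleState_mem hm₁ hm₂) h), pairing_indicatorOn,
      Finset.sum_eq_single (minusOn _ {through _ hN 0})]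
    · rw [if_pos (negCount_minusOn_singleton _), minusSum_apply, if_pos ⟨h, rfl⟩, Int.cast_one]
    · intro τ _ hτ
      have : minusSum hN n₁ n₂ 0 ⟨middleState h₁ h₂ m₁ m₂, τ⟩ = 0 := by
        rw [minusSum_apply]
        exact if_neg fun h => hτ h.2
      rw [this, Int.cast_zero, ite_self]
    · exact fun h => absurd (Finset.mem_univ _) h
  · rw [pairing_indicatorOn_minusSum_of_notMem hN _ h, if_neg]
    rintro ⟨rfl, rfl⟩
    exact h (middleState_mem hm₁ hm₂)

theorem minusSum_corner (hN : 0 < h₁ + h₂) {m₁ m₂ : ℕ} (hm₁ : 1 ≤ m₁) (hm₂ : 1 ≤ m₂) :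
    minusSum hN m₁ m₂ h₁ = minusSum hN m₁ m₂ 0 := by
  unfold minusSum stateSum
  refine Finset.sum_congr rfl fun s hs => ?_
  simp only [(corners_of_type hN hs hm₁ hm₂).1]

end PDCode.Monocircular

/-! ### Homology classes, and the theorem. -/

namespace PDCode

theorem homologyClass_eq_iff {N : ℕ} {D : PDCode N} (v w : D.cycles ℤ) :
    D.homologyClass ℤ v = D.homologyClass ℤ w ↔
      ∃ c, D.differential ℤ c = (v : D.Chain ℤ) - w := by
  unfold homologyClass
  rw [Submodule.Quotient.eq]
  rfl

theorem homologyClass_eq_zero_iff {N : ℕ} {D : PDCode N} (v : D.cycles ℤ) :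
    D.homologyClass ℤ v = 0 ↔ ∃ c, D.differential ℤ c = (v : D.Chain ℤ) := by
  rw [show (0 : D.Kh ℤ) = D.homologyClass ℤ 0 from rfl, homologyClass_eq_iff]
  simp

theorem homologyClass_mem_khOfDegree {N : ℕ} {D : PDCode N} {v : D.cycles ℤ} {i j : ℤ}
    (h : (v : D.Chain ℤ) ∈ D.chainsOfDegree ℤ i j) :
    D.homologyClass ℤ v ∈ D.khOfDegree ℤ i j :=
  ⟨v, h, rfl⟩

theorem addOrderOf_homologyClass_eq_two {N : ℕ} {D : PDCode N} (v : D.cycles ℤ)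
    (h : ∃ c, D.differential ℤ c = (2 : ℤ) • (v : D.Chain ℤ))
    (h' : ¬ ∃ c, D.differential ℤ c = (v : D.Chain ℤ)) :
    addOrderOf (D.homologyClass ℤ v) = 2 := by
  refine addOrderOf_eq_prime ?_ (mt (homologyClass_eq_zero_iff v).1 h')
  have : 2 • D.homologyClass ℤ v = D.homologyClass ℤ ((2 : ℤ) • v) := by
    rw [two_nsmul, two_zsmul]
    rfl
  rw [this, homologyClass_eq_zero_iff]
  exact h

end PDCode

open PDCode PDCode.Monocircular

theorem proposition7p2 (h₁ h₂ : ℕ) (hh₁ : 2 ≤ h₁) (hh₂ : 2 ≤ h₂)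
    (μ μ' : ℕ) (hμ : Odd μ) (hμlt : μ < h₁) (hμ' : Odd μ') (hμlt' : μ' < h₂) :
    ∃ (hV : chainLeft h₁ h₂ μ ∈ (monocircular h₁ h₂).cycles ℤ)
      (hV' : chainRight h₁ h₂ μ' ∈ (monocircular h₁ h₂).cycles ℤ),
      -- both classes are torsion elements of order two, in the stated bidegrees
      ((monocircular h₁ h₂).homologyClass ℤ ⟨chainLeft h₁ h₂ μ, hV⟩ ∈
          (monocircular h₁ h₂).khOfDegree ℤ (μ + 1) (2 * μ - 1) ∧
        addOrderOf ((monocircular h₁ h₂).homologyClass ℤ ⟨chainLeft h₁ h₂ μ, hV⟩) = 2) ∧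
      ((monocircular h₁ h₂).homologyClass ℤ ⟨chainRight h₁ h₂ μ', hV'⟩ ∈
          (monocircular h₁ h₂).khOfDegree ℤ (μ' + 1) (2 * μ' - 1) ∧
        addOrderOf ((monocircular h₁ h₂).homologyClass ℤ ⟨chainRight h₁ h₂ μ', hV'⟩) = 2) ∧
      -- they are the same element exactly when `μ = μ' = 1`
      ((monocircular h₁ h₂).homologyClass ℤ ⟨chainLeft h₁ h₂ μ, hV⟩ =
          (monocircular h₁ h₂).homologyClass ℤ ⟨chainRight h₁ h₂ μ', hV'⟩ ↔
        μ = 1 ∧ μ' = 1) := by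
  have hN : 0 < h₁ + h₂ := by omega
  have hpos := hμ.pos
  have hpos' := hμ'.pos
  have eL : chainLeft h₁ h₂ μ = -minusSum hN μ 1 0 := by
    rw [chainLeft, hμ.neg_one_pow, neg_one_smul, ladderSum_eq hN (by omega)]
    rfl
  have eR : chainRight h₁ h₂ μ' = minusSum hN 1 μ' 0 := by
    rw [chainRight, ladderSum_eq hN (by omega), ← minusSum_corner hN le_rfl hpos']
    rfl
  have pd : ∀ m₁ m₂, 1 ≤ m₁ → m₁ < h₁ → 1 ≤ m₂ → m₂ < h₂ → ∀ c,
      pairing (detector hN m₁ m₂) ((monocircular h₁ h₂).differential ℤ c) = 0 :=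
    fun m₁ m₂ a b c d => pairing_differential _ (pairing_detector_incidence hN a b c d)
  have pL : ∀ m₁ m₂, m₁ < h₁ → m₂ < h₂ → pairing (detector hN m₁ m₂) (chainLeft h₁ h₂ μ) =
      if m₁ = μ ∧ m₂ = 1 then 1 else 0 := fun m₁ m₂ h h' => by
    rw [eL, pairing_neg, pairing_detector_minusSum hN hpos le_rfl h h']
  have pR : ∀ m₁ m₂, m₁ < h₁ → m₂ < h₂ → pairing (detector hN m₁ m₂) (chainRight h₁ h₂ μ') =
      if m₁ = 1 ∧ m₂ = μ' then 1 else 0 := fun m₁ m₂ h h' => by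
    rw [eR, pairing_detector_minusSum hN le_rfl hpos' h h']
  refine ⟨?_, ?_, ⟨?_, ?_⟩, ⟨?_, ?_⟩, ?_⟩
  · rw [eL]
    exact neg_mem (minusSum_mem_cycles hN hpos le_rfl)
  · rw [eR]
    exact minusSum_mem_cycles hN le_rfl hpos'
  · refine homologyClass_mem_khOfDegree ?_
    have := neg_mem (minusSum_mem_chainsOfDegree hN hpos le_rfl (Or.inr rfl))
    rw [← eL] at this
    convert this using 2
    rw [Nat.cast_one]
    ring
  · refine addOrderOf_homologyClass_eq_two _ ?_ ?_
    · obtain ⟨c, hc⟩ := exists_differential_eq_two_smul hN hμ odd_one (Or.inr rfl)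
      exact ⟨-c, by rw [map_neg, hc]; change _ = (2 : ℤ) • chainLeft h₁ h₂ μ; rw [eL, smul_neg]⟩
    · rintro ⟨c, hc⟩
      have := pd μ 1 hpos hμlt le_rfl (by omega) c
      rw [hc] at this
      change pairing _ (chainLeft h₁ h₂ μ) = 0 at this
      rw [pL μ 1 hμlt (by omega), if_pos ⟨rfl, rfl⟩] at this
      exact one_ne_zero this
  · refine homologyClass_mem_khOfDegree ?_
    have := minusSum_mem_chainsOfDegree hN le_rfl hpos' (Or.inl rfl)
    rw [← eR] at this
    convert this using 2
    · rw [Nat.cast_one, add_comm]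
    · rw [Nat.cast_one]
      ring
  · refine addOrderOf_homologyClass_eq_two _ ?_ ?_
    · obtain ⟨c, hc⟩ := exists_differential_eq_two_smul hN odd_one hμ' (Or.inl rfl)
      exact ⟨c, by rw [hc]; change _ = (2 : ℤ) • chainRight h₁ h₂ μ'; rw [eR]⟩
    · rintro ⟨c, hc⟩
      have := pd 1 μ' le_rfl (by omega) hpos' hμlt' c
      rw [hc] at this
      change pairing _ (chainRight h₁ h₂ μ') = 0 at this
      rw [pR 1 μ' (by omega) hμlt', if_pos ⟨rfl, rfl⟩] at this
      exact one_ne_zero this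
  · rw [homologyClass_eq_iff]
    change (∃ c, _ = chainLeft h₁ h₂ μ - chainRight h₁ h₂ μ') ↔ _
    constructor
    · rintro ⟨c, hc⟩
      by_contra hne
      -- The detector of type $(\mu,1)$ is $1$ on $V(\mu,0)$. It is $0$ on $V(0,\mu')$, whose type
      -- $(1,\mu')$ is different by `hne`.
      have h1 := pd μ 1 hpos hμlt le_rfl (by omega) c
      rw [hc, sub_eq_add_neg, pairing_add, pairing_neg, pL μ 1 hμlt (by omega),
        pR μ 1 hμlt (by omega), if_pos ⟨rfl, rfl⟩, if_neg (by omega), add_zero] at h1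
      exact one_ne_zero h1
    -- Now $V(1,0)=-z(1,1)$ and $V(0,1)=z(1,1)$, so their difference is $-2z(1,1)$, a boundary.
    · rintro ⟨rfl, rfl⟩
      obtain ⟨c, hc⟩ := exists_differential_eq_two_smul hN hμ hμ' (Or.inl rfl)
      refine ⟨-c, ?_⟩
      rw [map_neg, hc, eL, eR, two_smul]
      abel
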